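/- Let $d\ge 1$, $A>0$, $\gamma>1$, and assume $\gamma\le 1+\frac1{d-1}$ if $d\ge2$ (no upper bound on $\gamma$ if $d=1$). Put $p(\rho)=A\rho^\gamma$, $\rho e=\frac{p(\rho)}{\gamma-1}$ and $c=\sqrt{p'(\rho)}=\sqrt{\gamma A}\,\rho^{(\gamma-1)/2}$. Let $\rho\ge0$ and $u$ be measurable on $(0,\infty)\times\mathbb R^d$, with $\rho$ and $\rho u$ locally bounded and $\rho|u|^2,\rho|u|^3$ locally integrable there, such that $(\rho,\rho u)$ is a solution of the Euler system $$\partial_t\rho+\mathrm{div}(\rho u)=0,\qquad \partial_t(\rho u)+\mathrm{Div}(\rho u\otimes u)+\nabla p(\rho)=0$$ satisfying the energy inequality $$\partial_t\Big(\tfrac12\rho|u|^2+\rho e\Big)+\mathrm{div}\Big(\big(\tfrac12\rho|u|^2+\rho e+p(\rho)\big)u\Big)\le0,$$ all in the sense of distributions on $(0,\infty)\times\mathbb R^d$. Let $\Omega$ be a nonempty, relatively open subset of $[0,\infty)\times\mathbb R^d$ whose sections $\Omega(t)=\{x:(t,x)\in\Omega\}$ are bounded, and let $\partial\Omega$ denote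 its boundary relative to $[0,\infty)\times\mathbb R^d$. Assume that $\Omega$ has a smooth boundary, in the sense that near each point of $\partial\Omega$ it is a set $\{g<0\}$ for some $C^1$ function $g(t,x)$ with $\nabla_xg\neq0$ at that point. Assume that $\Omega$ is the region occupied by the gas: $\rho=0$ almost everywhere outside $\Omega$, and every point of $\partial\Omega$ belongs to the support of $\rho$ (that is, $\rho$ does not vanish almost everywhere, for $t>0$, in any neighborhood of that point). Assume finally that $(c,u)$ is of class $C^1$, up to $t=0$, in a neighborhood of $\partial\Omega$ in $[0,\infty)\times\mathbb R^d$, and let $u_0=u(0,\cdot)$. Then necessarily $$\int_{\Omega(0)}\det\nabla u_0(x)\,dx>0 .$$ Here, since $u_0$ need not be differentiable away from $\partial\Omega(0)$, the integral is understood as $\int_{\Omega(0)}\det\nabla v\,dx$, where $v$ is a vector field of class $C^1$ in a neighborhood of $\overline{\Omega(0)}$ with $v=u_0$ on $\partial\Omega(0)$: such fields $v$ exist, and the inequality holds for every one of them (in particular for $v=u_0$ if $u_0$ is $C^1$ near $\overline{\Omega(0)}$). -/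

import Mathlib

open MeasureTheory Set
open scoped Topology ContDiff

noncomputable section

namespace EulerVacuum

/-- The physical space `ℝ^d`, with its Euclidean norm. -/
abbrev Space (d : ℕ) : Type := EuclideanSpace ℝ (Fin d)

/-- Space-time points `(t, x)`. -/
abbrev SpaceTime (d : ℕ) : Type := ℝ × Space d

/-- The open half-space `(0,∞) × ℝ^d`. -/
def openHalf (d : ℕ) : Set (SpaceTime d) := {z | 0 < z.1}

/-- The closed half-space `[0,∞) × ℝ^d`. -/
def closedHalf (d : ℕ) : Set (SpaceTime d) := {z | 0 ≤ z.1}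

/-- The polytropic pressure `p(ρ) = A ρ^γ`. -/
def pressure (A γ r : ℝ) : ℝ := A * r ^ γ

/-- The sound speed `c = √(p'(ρ)) = √(γ A) ρ^κ`, with `κ = (γ - 1) / 2`. -/
def soundSpeed (A γ r : ℝ) : ℝ := Real.sqrt (γ * A) * r ^ ((γ - 1) / 2)

/-- The mechanical energy density `½ ρ |u|² + ρ e`, where `ρ e = p / (γ - 1)`. -/
def energyDensity {d : ℕ} (A γ r : ℝ) (w : Space d) : ℝ :=
  1 / 2 * r * ‖w‖ ^ 2 + pressure A γ r / (γ - 1)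

/-- Test functions on `(0,∞) × ℝ^d`. -/
structure IsTest {d : ℕ} (φ : SpaceTime d → ℝ) : Prop where
  smooth : ContDiff ℝ ∞ φ
  compact : HasCompactSupport φ
  supp : tsupport φ ⊆ openHalf d

/-- Time derivative of a function of `(t, x)`. -/
def dt {d : ℕ} (φ : SpaceTime d → ℝ) (z : SpaceTime d) : ℝ := fderiv ℝ φ z (1, 0)

/-- Spatial derivative of a function of `(t, x)` in the direction `e`, that is `e · ∇φ`. -/
def dx {d : ℕ} (φ : SpaceTime d → ℝ) (z : SpaceTime d) (e : Space d) : ℝ :=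
  fderiv ℝ φ z (0, e)

/-- `(ρ, ρ u)` is a locally bounded weak (distributional) solution of the isentropic Euler system
`∂ₜρ + div(ρu) = 0`, `∂ₜ(ρu) + Div(ρu⊗u) + ∇p(ρ) = 0` in `(0,∞) × ℝ^d`, admissible in the sense
that `∂ₜ(½ρ|u|²+ρe) + div((½ρ|u|²+ρe+p)u) ≤ 0` in the sense of distributions.
The local integrability of `ρ|u|²` and `ρ|u|³` gives a meaning to all the terms (it is automatic
when `u` itself is locally bounded). -/
structure IsAdmissibleSolution {d : ℕ} (A γ : ℝ) (ρ : SpaceTime d → ℝ)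
    (u : SpaceTime d → Space d) : Prop where
  meas_density : AEStronglyMeasurable ρ (volume.restrict (openHalf d))
  meas_velocity : AEStronglyMeasurable u (volume.restrict (openHalf d))
  density_nonneg : ∀ z ∈ closedHalf d, 0 ≤ ρ z
  locally_bounded : ∀ K : Set (SpaceTime d), IsCompact K → K ⊆ openHalf d →
    ∃ C : ℝ, ∀ᵐ z ∂(volume.restrict K), ρ z ≤ C ∧ ‖ρ z • u z‖ ≤ C
  integrable_sq : LocallyIntegrableOn (fun z => ρ z * ‖u z‖ ^ 2) (openHalf d)
  integrable_cube : LocallyIntegrableOn (fun z => ρ z * ‖u z‖ ^ 3) (openHalf d)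
  mass : ∀ φ : SpaceTime d → ℝ, IsTest φ →
    ∫ z in openHalf d, (ρ z * dt φ z + ρ z * dx φ z (u z)) = 0
  momentum : ∀ φ : SpaceTime d → ℝ, IsTest φ → ∀ i : Fin d,
    ∫ z in openHalf d, (ρ z * u z i * dt φ z + ρ z * u z i * dx φ z (u z)
      + pressure A γ (ρ z) * dx φ z (EuclideanSpace.single i 1)) = 0
  energy : ∀ φ : SpaceTime d → ℝ, IsTest φ → (∀ z, 0 ≤ φ z) →
    0 ≤ ∫ z in openHalf d, (energyDensity A γ (ρ z) (u z) * dt φ z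
      + (energyDensity A γ (ρ z) (u z) + pressure A γ (ρ z)) * dx φ z (u z))

/-- The section `Ω(t)` of a space-time set `Ω`. -/
def slice {d : ℕ} (Ω : Set (SpaceTime d)) (t : ℝ) : Set (Space d) := {x | (t, x) ∈ Ω}

/-- The front `∂Ω`: the boundary of `Ω` relative to `[0,∞) × ℝ^d`, for a relatively open `Ω`. -/
def front {d : ℕ} (Ω : Set (SpaceTime d)) : Set (SpaceTime d) := closure Ω \ Ω

/-- `Ω` is a nonempty, relatively open subset of `[0,∞) × ℝ^d`, bounded in space at each time,
whose boundary is a `C¹` family of `C¹` hypersurfaces `∂Ω(t)`: near each point of the front, `Ω`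
is a sublevel set `{g < 0}` of a `C¹` function `g` of `(t, x)` with nonzero spatial gradient. -/
structure IsMovingDomain {d : ℕ} (Ω : Set (SpaceTime d)) : Prop where
  nonempty : Ω.Nonempty
  rel_open : ∃ U : Set (SpaceTime d), IsOpen U ∧ Ω = U ∩ closedHalf d
  bounded : ∀ t : ℝ, 0 ≤ t → Bornology.IsBounded (slice Ω t)
  boundary : ∀ z ∈ front Ω, ∃ (W : Set (SpaceTime d)) (g : SpaceTime d → ℝ),
    IsOpen W ∧ z ∈ W ∧ ContDiffOn ℝ 1 g W ∧ (∃ e : Space d, dx g z e ≠ 0) ∧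
      ∀ y ∈ W ∩ closedHalf d, (y ∈ Ω ↔ g y < 0)

/-- `Ω` is the region of the gas: `ρ` vanishes almost everywhere outside `Ω`, and the front is a
genuine boundary of the gas, that is, it is contained in the (essential) support of `ρ`. -/
structure IsGasRegion {d : ℕ} (Ω : Set (SpaceTime d)) (ρ : SpaceTime d → ℝ) : Prop where
  vacuum_outside : ∀ᵐ z ∂(volume.restrict (openHalf d)), z ∉ Ω → ρ z = 0
  front_subset_support : ∀ z ∈ front Ω, ∀ V ∈ 𝓝 z,
    ¬ ∀ᵐ y ∂(volume.restrict (V ∩ openHalf d)), ρ y = 0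

/-- `(c, u)` is of class `C¹` (up to `t = 0`) in a neighborhood of the front. -/
def IsC1NearFront {d : ℕ} (A γ : ℝ) (Ω : Set (SpaceTime d)) (ρ : SpaceTime d → ℝ)
    (u : SpaceTime d → Space d) : Prop :=
  ∃ N : Set (SpaceTime d), IsOpen N ∧ front Ω ⊆ N ∧
    ContDiffOn ℝ 1 (fun z => soundSpeed A γ (ρ z)) (N ∩ closedHalf d) ∧
    ContDiffOn ℝ 1 u (N ∩ closedHalf d)

/-- `v` is a vector field of class `C¹` near the closure of `D` which agrees with `u₀` on `∂D`. -/
def IsC1Extension {d : ℕ} (D : Set (Space d)) (u₀ v : Space d → Space d) : Prop :=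
  (∃ W : Set (Space d), IsOpen W ∧ closure D ⊆ W ∧ ContDiffOn ℝ 1 v W) ∧
    ∀ x ∈ frontier D, v x = u₀ x

end EulerVacuum

end

/-! Two facts conflict unless the integral is positive: the volume of the gas region is a polynomial
in time whose `t ^ d` coefficient is the integral of `det ∇v`, and a gas of finite energy disperses
too strongly for its volume to be `O(t ^ (d - 1))`.

Kinematics. Near the front and where `ρ > 0`, the system reads `D_t c = -κ c div u`, `D_t u = -κ⁻¹ c
∇c`, with `κ = (γ - 1) / 2` and `D_t` the derivative along `(1, u)`. A maximum principle applied to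
the first equation shows that `(1, u)` is tangent to the front (`tangent`). As `c = 0` there, the
second shows that front points are not accelerated (`acceleration_front`). A Gronwall argument then
makes each front point move along a straight line at constant velocity, for all times `≥ 0`
(`line_mem_front`). So for `s` near `t`, `Ω(s)` is the image of `Ω(t)` under `x + (s - t) w(x)`,
where `w` is any Lipschitz extension of the boundary velocity (`image_slice_eq`); for `w` of class
`C¹` with compact support its volume is the integral of `det (1 + (s - t) ∇w)`. These local
polynomials are continued to a single one, whose top coefficient is computed at time `0` from `v`
(`exists_volume_slice_eq`).

Dynamics. Mass, momentum and energy tested against `|x|² / 2`, `t x` and `t²` show that the integral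
of `½ ρ |x - t u|² + t² ρ e` has time derivative at most `(2 - d (γ - 1)) t ∫ ρ e`
(`dispersion_test`). Consequently time averages of `∫ p` are `O(t ^ (-min 2 (d (γ - 1))))`
(`exists_pressure_decay`). If the top coefficient were `≤ 0`, the volume would be `O(t ^ (d - 1))`,
and interpolating the mass between volume and `∫ ρ ^ γ` (`mass_le`) would force the conserved,
positive mass to vanish, because `(d - 1) (γ - 1) < min 2 (d (γ - 1))` (`leadingCoeff_pos`). -/

namespace EulerVacuum

/-! ### From distributional to classical divergence-free fields. -/

section

theorem continuous_mul_of_tsupport_subset {E : Type*} [TopologicalSpace E] {O : Set E}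
    (hO : IsOpen O) {f g : E → ℝ}
    (hf : ContinuousOn f O) (hg : Continuous g) (hgO : tsupport g ⊆ O) :
    Continuous fun z => f z * g z := by
  rw [continuous_iff_continuousAt]
  intro z
  by_cases hz : z ∈ tsupport g
  · exact (hf.continuousAt (hO.mem_nhds (hgO hz))).mul hg.continuousAt
  · have : (fun z => f z * g z) =ᶠ[𝓝 z] fun _ => 0 := by
      filter_upwards [(isClosed_tsupport g).isOpen_compl.mem_nhds hz] with y hy
      simp [image_eq_zero_of_notMem_tsupport hy]
    exact continuousAt_const.congr this.symm

section WeakDivergence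

variable {E : Type*} [NormedAddCommGroup E] [NormedSpace ℝ E]
  [FiniteDimensional ℝ E] [MeasurableSpace E] [BorelSpace E] {μ : Measure E} [μ.IsAddHaarMeasure]

/-- A vector field of class `C¹` on an open set, given by its components `f k` along vectors `e k`,
is divergence free as soon as it is so in the sense of distributions. -/
theorem sum_fderiv_eq_zero_of_weak {ι : Type*} [Fintype ι] {O : Set E} (hO : IsOpen O)
    {f : ι → E → ℝ} (e : ι → E) (hf : ∀ k, ContDiffOn ℝ 1 (f k) O)
    (h : ∀ φ : E → ℝ, ContDiff ℝ ∞ φ → HasCompactSupport φ → tsupport φ ⊆ O →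
      ∫ z, ∑ k, f k z * fderiv ℝ φ z (e k) ∂μ = 0) :
    ∀ z ∈ O, ∑ k, fderiv ℝ (f k) z (e k) = 0 := by
  have hcont : ∀ k, ContinuousOn (fun z => fderiv ℝ (f k) z (e k)) O := fun k =>
    ((hf k).continuousOn_fderiv_of_isOpen hO le_rfl).clm_apply continuousOn_const
  have hsum : ContinuousOn (fun z => ∑ k, fderiv ℝ (f k) z (e k)) O :=
    continuousOn_finsetSum _ fun k _ => hcont k
  have key : ∀ᵐ z ∂μ, z ∈ O → ∑ k, fderiv ℝ (f k) z (e k) = 0 := by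
    refine hO.ae_eq_zero_of_integral_contDiff_smul_eq_zero
      (hsum.locallyIntegrableOn hO.measurableSet) ?_
    intro φ hφ hc hs
    have hφ' : ∀ k, Continuous fun z => fderiv ℝ φ z (e k) := fun k =>
      (hφ.continuous_fderiv (by simp)).clm_apply continuous_const
    have hsub : ∀ k, tsupport (fun z => fderiv ℝ φ z (e k)) ⊆ O := fun k =>
      (tsupport_fderiv_apply_subset ℝ (e k)).trans hs
    have hck : ∀ k, HasCompactSupport (fun z => fderiv ℝ φ z (e k)) := fun k =>
      hc.fderiv_apply (𝕜 := ℝ) (e k)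
    have i1 : ∀ k, Integrable (fun z => f k z * fderiv ℝ φ z (e k)) μ := fun k =>
      (continuous_mul_of_tsupport_subset hO (hf k).continuousOn (hφ' k)
        (hsub k)).integrable_of_hasCompactSupport (hck k).mul_left
    have i2 : ∀ k, Integrable (fun z => fderiv ℝ (f k) z (e k) * φ z) μ := fun k =>
      (continuous_mul_of_tsupport_subset hO (hcont k) hφ.continuous
        hs).integrable_of_hasCompactSupport hc.mul_left
    have i3 : ∀ k, Integrable (fun z => f k z * φ z) μ := fun k =>
      (continuous_mul_of_tsupport_subset hO (hf k).continuousOn hφ.continuous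
        hs).integrable_of_hasCompactSupport hc.mul_left
    have hparts : ∀ k, ∫ z, fderiv ℝ (f k) z (e k) * φ z ∂μ
        = - ∫ z, f k z * fderiv ℝ φ z (e k) ∂μ := by
      intro k
      rw [integral_mul_fderiv_eq_neg_fderiv_mul_of_integrable (i2 k) (i1 k) (i3 k), neg_neg]
      · exact fun z hz => ((hf k).contDiffAt (hO.mem_nhds (hs hz))).differentiableAt one_ne_zero
      · exact fun z _ => (hφ.differentiable (by simp)) z
    calc ∫ z, φ z • ∑ k, fderiv ℝ (f k) z (e k) ∂μ
        = ∫ z, ∑ k, fderiv ℝ (f k) z (e k) * φ z ∂μ := by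
          congr 1; ext z; rw [smul_eq_mul, mul_comm, Finset.sum_mul]
      _ = - ∫ z, ∑ k, f k z * fderiv ℝ φ z (e k) ∂μ := by
          rw [integral_finsetSum _ fun k _ => i2 k, integral_finsetSum _ fun k _ => i1 k,
            ← Finset.sum_neg_distrib]
          exact Finset.sum_congr rfl fun k _ => hparts k
      _ = 0 := by rw [h φ hφ hc hs, neg_zero]
  have hae : (fun z => ∑ k, fderiv ℝ (f k) z (e k)) =ᵐ[μ.restrict O] fun _ => (0 : ℝ) := by
    rw [Filter.EventuallyEq, ae_restrict_iff' hO.measurableSet]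
    exact key
  exact fun z hz => Measure.eqOn_open_of_ae_eq hae hO hsum continuousOn_const hz

end WeakDivergence

end

/-! ### The Euler system in classical form where the density is `C¹`. -/

section

variable {d : ℕ}

/-- The spatial divergence of a velocity field. -/
noncomputable def divergence (u : SpaceTime d → Space d) (z : SpaceTime d) : ℝ :=
  ∑ j, fderiv ℝ u z (0, EuclideanSpace.single j 1) j

instance : (volume : Measure (SpaceTime d)).IsAddHaarMeasure :=
  inferInstanceAs (Measure.prod (volume : Measure ℝ) (volume : Measure (Space d))).IsAddHaarMeasure

theorem sum_smul_single (w : Space d) : ∑ j, w j • EuclideanSpace.single j (1 : ℝ) = w := by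
  simpa using (EuclideanSpace.basisFun (Fin d) ℝ).sum_repr w

theorem map_zero_prod_eq_sum (L : SpaceTime d →L[ℝ] ℝ) (w : Space d) :
    L (0, w) = ∑ j, w j * L (0, EuclideanSpace.single j 1) := by
  have h : (0, w) = ∑ j, w j • ((0, EuclideanSpace.single j 1) : SpaceTime d) := by
    rw [Prod.ext_iff]
    simp only [Prod.fst_sum, Prod.snd_sum, Prod.smul_fst, Prod.smul_snd, smul_zero,
      Finset.sum_const_zero, true_and]
    exact (sum_smul_single w).symm
  conv_lhs => rw [h]
  simp only [map_sum, map_smul, smul_eq_mul]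

theorem map_one_prod_eq (L : SpaceTime d →L[ℝ] ℝ) (w : Space d) :
    L (1, w) = L (1, 0) + L (0, w) := by
  rw [← map_add]; simp

theorem isOpen_openHalf : IsOpen (openHalf d) := isOpen_lt continuous_const continuous_fst

theorem coord_fderiv {u : SpaceTime d → Space d} {z : SpaceTime d} (hu : DifferentiableAt ℝ u z)
    (i : Fin d) (v : SpaceTime d) : fderiv ℝ (fun y => u y i) z v = fderiv ℝ u z v i := by
  have h := ((EuclideanSpace.proj (𝕜 := ℝ) i).hasFDerivAt.comp z hu.hasFDerivAt).fderiv
  have h' : fderiv ℝ (fun y => u y i) z = (EuclideanSpace.proj (𝕜 := ℝ) i).comp (fderiv ℝ u z) := h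
  rw [h']; rfl

theorem contDiffOn_coord {u : SpaceTime d → Space d} {O : Set (SpaceTime d)}
    (hu : ContDiffOn ℝ 1 u O) (i : Fin d) : ContDiffOn ℝ 1 (fun y => u y i) O :=
  (EuclideanSpace.proj (𝕜 := ℝ) i).contDiff.comp_contDiffOn hu

/-- Space-time form of `sum_fderiv_eq_zero_of_weak`. -/
theorem dt_add_sum_dx_eq_zero_of_weak {O : Set (SpaceTime d)} (hO : IsOpen O)
    (hOH : O ⊆ openHalf d) {f₀ : SpaceTime d → ℝ} {f : Fin d → SpaceTime d → ℝ}
    (h₀ : ContDiffOn ℝ 1 f₀ O) (hf : ∀ j, ContDiffOn ℝ 1 (f j) O)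
    (h : ∀ φ, IsTest φ → ∫ z in openHalf d, (f₀ z * dt φ z
      + ∑ j, f j z * dx φ z (EuclideanSpace.single j 1)) = 0) :
    ∀ z ∈ O, dt f₀ z + ∑ j, dx (f j) z (EuclideanSpace.single j 1) = 0 := by
  intro z hz
  -- The index `none` carries the time direction, so that the balance law is a single space-time
  -- divergence.
  have key := sum_fderiv_eq_zero_of_weak (μ := (volume : Measure (SpaceTime d))) hO
    (f := fun k : Option (Fin d) => k.elim f₀ f)
    (fun k : Option (Fin d) => k.elim (1, 0) fun j => (0, EuclideanSpace.single j 1))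
    (by rintro (_ | j)
        · exact h₀
        · exact hf j)
    (by
      intro φ hφ hc hs
      refine Eq.trans ?_ (h φ ⟨hφ, hc, hs.trans hOH⟩)
      rw [setIntegral_eq_integral_of_forall_compl_eq_zero]
      · refine integral_congr_ae (ae_of_all _ fun y => ?_)
        simp [Fintype.sum_option, dt, dx]
      · intro y hy
        have hy' : y ∉ tsupport φ := fun h' => hy (hOH (hs h'))
        have : fderiv ℝ φ y = 0 := by
          by_contra h0
          exact hy' (support_fderiv_subset ℝ h0)
        simp [dt, dx, this]) z hz
  simpa [Fintype.sum_option, dt, dx] using key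

variable {A γ : ℝ} {ρ : SpaceTime d → ℝ} {u : SpaceTime d → Space d} {O : Set (SpaceTime d)}

/-- The mass equation in the classical sense. -/
theorem IsAdmissibleSolution.mass_classical (hsol : IsAdmissibleSolution A γ ρ u)
    (hO : IsOpen O) (hOH : O ⊆ openHalf d) (hρ : ContDiffOn ℝ 1 ρ O) (hu : ContDiffOn ℝ 1 u O)
    {z : SpaceTime d} (hz : z ∈ O) : fderiv ℝ ρ z (1, u z) + ρ z * divergence u z = 0 := by
  have key := dt_add_sum_dx_eq_zero_of_weak hO hOH hρ (f := fun j z => ρ z * u z j)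
    (fun j => hρ.mul (contDiffOn_coord hu j)) (by
      intro φ hφ
      refine Eq.trans ?_ (hsol.mass φ hφ)
      congr 1; ext y
      rw [dx, map_zero_prod_eq_sum, Finset.mul_sum]
      simp only [dx, mul_assoc]) z hz
  have dρ : DifferentiableAt ℝ ρ z := (hρ.contDiffAt (hO.mem_nhds hz)).differentiableAt one_ne_zero
  have du : DifferentiableAt ℝ u z := (hu.contDiffAt (hO.mem_nhds hz)).differentiableAt one_ne_zero
  have dui : ∀ i, DifferentiableAt ℝ (fun y => u y i) z := fun i =>
    ((contDiffOn_coord hu i).contDiffAt (hO.mem_nhds hz)).differentiableAt one_ne_zero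
  rw [map_one_prod_eq, map_zero_prod_eq_sum, divergence, Finset.mul_sum, add_assoc,
    ← Finset.sum_add_distrib]
  refine Eq.trans ?_ key
  rw [dt]
  congr 1
  refine Finset.sum_congr rfl fun j _ => ?_
  rw [dx, fderiv_fun_mul dρ (dui j)]
  simp [coord_fderiv du]
  ring

/-- The momentum equation in the classical sense. -/
theorem IsAdmissibleSolution.momentum_classical (hsol : IsAdmissibleSolution A γ ρ u)
    (hO : IsOpen O) (hOH : O ⊆ openHalf d) (hρ : ContDiffOn ℝ 1 ρ O) (hu : ContDiffOn ℝ 1 u O)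
    (hp : ContDiffOn ℝ 1 (fun z => pressure A γ (ρ z)) O)
    {z : SpaceTime d} (hz : z ∈ O) (i : Fin d) :
    ρ z * fderiv ℝ u z (1, u z) i
      + fderiv ℝ (fun z => pressure A γ (ρ z)) z (0, EuclideanSpace.single i 1) = 0 := by
  classical
  have cf : ∀ j, ContDiffOn ℝ 1 (fun z => ρ z * u z i * u z j
      + if j = i then pressure A γ (ρ z) else 0) O := by
    intro j
    refine ((hρ.mul (contDiffOn_coord hu i)).mul (contDiffOn_coord hu j)).add ?_
    split_ifs
    · exact hp
    · exact contDiffOn_const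
  have key := dt_add_sum_dx_eq_zero_of_weak hO hOH (hρ.mul (contDiffOn_coord hu i))
    (f := fun j z => ρ z * u z i * u z j + if j = i then pressure A γ (ρ z) else 0)
    cf (by
      intro φ hφ
      refine Eq.trans ?_ (hsol.momentum φ hφ i)
      congr 1; ext y
      rw [dx, map_zero_prod_eq_sum, Finset.mul_sum]
      simp only [add_mul, Finset.sum_add_distrib, ite_mul, zero_mul, Finset.sum_ite_eq',
        Finset.mem_univ, if_true, dx, mul_assoc]
      ring) z hz
  have hmass := hsol.mass_classical hO hOH hρ hu hz
  have dρ : DifferentiableAt ℝ ρ z := (hρ.contDiffAt (hO.mem_nhds hz)).differentiableAt one_ne_zero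
  have dp := (hp.contDiffAt (hO.mem_nhds hz)).differentiableAt one_ne_zero
  have du : DifferentiableAt ℝ u z := (hu.contDiffAt (hO.mem_nhds hz)).differentiableAt one_ne_zero
  have dui : ∀ i, DifferentiableAt ℝ (fun y => u y i) z := fun i =>
    ((contDiffOn_coord hu i).contDiffAt (hO.mem_nhds hz)).differentiableAt one_ne_zero
  have hterm : ∀ j, dx (fun z => ρ z * u z i * u z j + if j = i then pressure A γ (ρ z) else 0) z
      (EuclideanSpace.single j 1) =
      ρ z * u z i * fderiv ℝ u z (0, EuclideanSpace.single j 1) j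
      + ρ z * (u z j * fderiv ℝ u z (0, EuclideanSpace.single j 1) i)
      + u z i * (u z j * fderiv ℝ ρ z (0, EuclideanSpace.single j 1))
      + if j = i then fderiv ℝ (fun z => pressure A γ (ρ z)) z (0, EuclideanSpace.single i 1)
        else 0 := by
    intro j
    have hm := fderiv_fun_mul (dρ.fun_mul (dui i)) (dui j)
    rw [fderiv_fun_mul dρ (dui i)] at hm
    by_cases hj : j = i
    · subst hj
      simp only [if_true, dx]
      rw [fderiv_fun_add ((dρ.fun_mul (dui j)).fun_mul (dui j)) dp, hm]
      simp [coord_fderiv du]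
      ring
    · simp only [hj, if_false, dx, add_zero]
      rw [hm]
      simp [coord_fderiv du]
      ring
  have h0 : dt (ρ * fun z => u z i) z = ρ z * fderiv ℝ u z (1, 0) i
      + u z i * fderiv ℝ ρ z (1, 0) := by
    rw [dt, fderiv_mul dρ (dui i)]
    simp [coord_fderiv du]
  have hXu : fderiv ℝ u z (1, u z) i = fderiv ℝ u z (1, 0) i
      + ∑ j, u z j * fderiv ℝ u z (0, EuclideanSpace.single j 1) i := by
    rw [← coord_fderiv du, map_one_prod_eq, map_zero_prod_eq_sum]
    simp [coord_fderiv du]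
  rw [map_one_prod_eq, map_zero_prod_eq_sum, divergence] at hmass
  have key' : dt (ρ * fun z => u z i) z + ∑ j, dx (fun z => ρ z * u z i * u z j
      + if j = i then pressure A γ (ρ z) else 0) z (EuclideanSpace.single j 1) = 0 := key
  rw [h0, Finset.sum_congr rfl fun j _ => hterm j] at key'
  simp only [Finset.sum_add_distrib, ← Finset.mul_sum, Finset.sum_ite_eq', Finset.mem_univ,
    if_true] at key'
  rw [hXu]
  -- Subtracting `u z i` times the mass equation turns the conservative form into the
  -- nonconservative one.
  linear_combination key' - u z i * hmass

end

/-! ### Symmetrized equations for `(c, u)` away from vacuum. -/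

section

variable {d : ℕ} {A γ : ℝ} {ρ : SpaceTime d → ℝ} {u : SpaceTime d → Space d}
  {O : Set (SpaceTime d)}

theorem soundSpeed_nonneg {r : ℝ} (hr : 0 ≤ r) : 0 ≤ soundSpeed A γ r :=
  mul_nonneg (Real.sqrt_nonneg _) (Real.rpow_nonneg hr _)

theorem soundSpeed_pos (hA : 0 < A) (hγ : 1 < γ) {r : ℝ} (hr : 0 < r) : 0 < soundSpeed A γ r :=
  mul_pos (Real.sqrt_pos.2 (by positivity)) (Real.rpow_pos_of_pos hr _)

theorem soundSpeed_zero (hγ : 1 < γ) : soundSpeed A γ 0 = 0 := by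
  rw [soundSpeed, Real.zero_rpow (by linarith : (γ - 1) / 2 ≠ 0), mul_zero]

/-- The density as a function of the sound speed. -/
theorem eq_rpow_soundSpeed (hA : 0 < A) (hγ : 1 < γ) {r : ℝ} (hr : 0 ≤ r) :
    r = (soundSpeed A γ r / Real.sqrt (γ * A)) ^ (2 / (γ - 1)) := by
  have h1 : Real.sqrt (γ * A) ≠ 0 := (Real.sqrt_pos.2 (by positivity)).ne'
  have h2 : γ - 1 ≠ 0 := by linarith
  rw [soundSpeed, mul_div_cancel_left₀ _ h1, ← Real.rpow_mul hr]
  have : (γ - 1) / 2 * (2 / (γ - 1)) = 1 := by field_simp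
  rw [this, Real.rpow_one]

theorem soundSpeed_eq_zero_iff (hA : 0 < A) (hγ : 1 < γ) {r : ℝ} (hr : 0 ≤ r) :
    soundSpeed A γ r = 0 ↔ r = 0 := by
  constructor
  · intro h
    by_contra h0
    exact (soundSpeed_pos hA hγ (lt_of_le_of_ne hr (Ne.symm h0))).ne' h
  · rintro rfl
    exact soundSpeed_zero hγ

/-- The density is the power `2 / (γ - 1)` of `c`, up to scaling. This exponent may be less than
`1`, so smoothness is only claimed where `c` does not vanish. -/
theorem contDiffOn_density (hA : 0 < A) (hγ : 1 < γ) (hpos : ∀ z ∈ O, 0 < ρ z)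
    (hc : ContDiffOn ℝ 1 (fun z => soundSpeed A γ (ρ z)) O) : ContDiffOn ℝ 1 ρ O := by
  have h := (hc.div_const (Real.sqrt (γ * A))).rpow_const_of_ne (p := 2 / (γ - 1)) (fun z hz =>
    (div_pos (soundSpeed_pos hA hγ (hpos z hz)) (Real.sqrt_pos.2 (by positivity))).ne')
  exact h.congr fun z hz => eq_rpow_soundSpeed hA hγ (hpos z hz).le

theorem hasFDerivAt_soundSpeed {z : SpaceTime d} (hz : 0 < ρ z) (hρ : DifferentiableAt ℝ ρ z) :
    HasFDerivAt (fun z => soundSpeed A γ (ρ z))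
      ((Real.sqrt (γ * A) * ((γ - 1) / 2 * ρ z ^ ((γ - 1) / 2 - 1))) • fderiv ℝ ρ z) z := by
  have h := (hρ.hasFDerivAt.rpow_const (p := (γ - 1) / 2) (Or.inl hz.ne')).const_mul
    (Real.sqrt (γ * A))
  rw [smul_smul] at h
  exact h

theorem hasFDerivAt_pressure {z : SpaceTime d} (hz : 0 < ρ z) (hρ : DifferentiableAt ℝ ρ z) :
    HasFDerivAt (fun z => pressure A γ (ρ z))
      ((A * (γ * ρ z ^ (γ - 1))) • fderiv ℝ ρ z) z := by
  have h := (hρ.hasFDerivAt.rpow_const (p := γ) (Or.inl hz.ne')).const_mul A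
  rw [smul_smul] at h
  exact h

/-- Transport equation for the sound speed away from vacuum. -/
theorem IsAdmissibleSolution.soundSpeed_transport (hsol : IsAdmissibleSolution A γ ρ u)
    (hA : 0 < A) (hγ : 1 < γ) (hO : IsOpen O) (hOH : O ⊆ openHalf d) (hpos : ∀ z ∈ O, 0 < ρ z)
    (hc : ContDiffOn ℝ 1 (fun z => soundSpeed A γ (ρ z)) O) (hu : ContDiffOn ℝ 1 u O)
    {z : SpaceTime d} (hz : z ∈ O) :
    fderiv ℝ (fun z => soundSpeed A γ (ρ z)) z (1, u z)
      = -((γ - 1) / 2 * soundSpeed A γ (ρ z) * divergence u z) := by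
  have hρ := contDiffOn_density hA hγ hpos hc
  have dρ : DifferentiableAt ℝ ρ z := (hρ.contDiffAt (hO.mem_nhds hz)).differentiableAt one_ne_zero
  have hm := hsol.mass_classical hO hOH hρ hu hz
  have hz0 := hpos z hz
  rw [(hasFDerivAt_soundSpeed hz0 dρ).fderiv, soundSpeed]
  have e : ρ z ^ ((γ - 1) / 2) = ρ z ^ ((γ - 1) / 2 - 1) * ρ z := by
    rw [Real.rpow_sub_one hz0.ne', div_mul_cancel₀ _ hz0.ne']
  rw [e]
  simp only [smul_apply, smul_eq_mul]
  linear_combination Real.sqrt (γ * A) * ((γ - 1) / 2) * ρ z ^ ((γ - 1) / 2 - 1) * hm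

/-- The acceleration of the gas in terms of the sound speed, away from vacuum. -/
theorem IsAdmissibleSolution.acceleration_eq (hsol : IsAdmissibleSolution A γ ρ u)
    (hA : 0 < A) (hγ : 1 < γ) (hO : IsOpen O) (hOH : O ⊆ openHalf d) (hpos : ∀ z ∈ O, 0 < ρ z)
    (hc : ContDiffOn ℝ 1 (fun z => soundSpeed A γ (ρ z)) O) (hu : ContDiffOn ℝ 1 u O)
    {z : SpaceTime d} (hz : z ∈ O) (i : Fin d) :
    fderiv ℝ u z (1, u z) i
      = -(2 / (γ - 1)) * (soundSpeed A γ (ρ z) *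
        fderiv ℝ (fun z => soundSpeed A γ (ρ z)) z (0, EuclideanSpace.single i 1)) := by
  have hρ := contDiffOn_density hA hγ hpos hc
  have dρ : DifferentiableAt ℝ ρ z := (hρ.contDiffAt (hO.mem_nhds hz)).differentiableAt one_ne_zero
  have hp : ContDiffOn ℝ 1 (fun z => pressure A γ (ρ z)) O :=
    contDiffOn_const.mul (hρ.rpow_const_of_ne fun z hz => (hpos z hz).ne')
  have hm := hsol.momentum_classical hO hOH hρ hu hp hz i
  have hz0 := hpos z hz
  rw [(hasFDerivAt_pressure hz0 dρ).fderiv] at hm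
  rw [(hasFDerivAt_soundSpeed hz0 dρ).fderiv, soundSpeed]
  simp only [smul_apply, smul_eq_mul] at hm ⊢
  have hγ1 : γ - 1 ≠ 0 := by linarith
  have hs : Real.sqrt (γ * A) * Real.sqrt (γ * A) = γ * A := Real.mul_self_sqrt (by positivity)
  -- With `κ = (γ - 1) / 2`, the exponents match: `∇p / ρ = γ A ρ ^ (2κ - 1) ∇ρ` and `c ∇c = κ γ A ρ
  -- ^ (2κ - 1) ∇ρ`, whence the factor `1 / κ = 2 / (γ - 1)`.
  have e1 : ρ z ^ (γ - 1) = ρ z ^ ((γ - 1) / 2) * ρ z ^ ((γ - 1) / 2 - 1) * ρ z := by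
    rw [Real.rpow_sub_one hz0.ne' ((γ - 1) / 2), mul_assoc, div_mul_cancel₀ _ hz0.ne',
      ← Real.rpow_add hz0]
    congr 1; ring
  rw [e1] at hm
  apply mul_left_cancel₀ hz0.ne'
  have h2 : 2 / (γ - 1) * ((γ - 1) / 2) = 1 := by field_simp
  set X := fderiv ℝ ρ z (0, EuclideanSpace.single i 1)
  linear_combination hm + ρ z * ρ z ^ ((γ - 1) / 2) * ρ z ^ ((γ - 1) / 2 - 1) * X *
    (2 / (γ - 1) * ((γ - 1) / 2)) * hs + γ * A * ρ z * ρ z ^ ((γ - 1) / 2)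
      * ρ z ^ ((γ - 1) / 2 - 1) * X * h2

end

/-! ### Local geometry of the front. -/

section

variable {d : ℕ} {A γ : ℝ} {ρ : SpaceTime d → ℝ} {u : SpaceTime d → Space d}
  {Ω W N : Set (SpaceTime d)} {g : SpaceTime d → ℝ} {e : Space d} {z : SpaceTime d}

theorem isClosed_closedHalf : IsClosed (closedHalf d) := isClosed_le continuous_const continuous_fst

theorem openHalf_subset_closedHalf : openHalf d ⊆ closedHalf d := fun z (hz : 0 < z.1) => hz.le

theorem convex_closedHalf : Convex ℝ (closedHalf d) :=
  (convex_Ici (0 : ℝ)).linear_preimage (LinearMap.fst ℝ ℝ (Space d))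

/-- This makes `fderivWithin` well determined and continuous up to `t = 0`, where ordinary
derivatives in time are not available. -/
theorem uniqueDiffOn_inter_closedHalf (hN : IsOpen N) : UniqueDiffOn ℝ (N ∩ closedHalf d) := by
  rw [inter_comm]
  refine (uniqueDiffOn_convex convex_closedHalf ?_).inter hN
  exact ⟨(1, 0), interior_maximal openHalf_subset_closedHalf isOpen_openHalf
    (show (0 : ℝ) < 1 from one_pos)⟩

theorem IsMovingDomain.subset_closedHalf (hΩ : IsMovingDomain Ω) : Ω ⊆ closedHalf d := by
  obtain ⟨U, -, rfl⟩ := hΩ.rel_open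
  exact inter_subset_right

theorem IsMovingDomain.front_subset_closedHalf (hΩ : IsMovingDomain Ω) :
    front Ω ⊆ closedHalf d :=
  sdiff_subset.trans (closure_minimal hΩ.subset_closedHalf isClosed_closedHalf)

/-- Within the closed half-space, removing `Ω` is the same as removing the open set `U` that cuts it
out. -/
theorem IsMovingDomain.isClosed_front (hΩ : IsMovingDomain Ω) : IsClosed (front Ω) := by
  obtain ⟨U, hU, h⟩ := hΩ.rel_open
  have : front Ω = closure Ω \ U := by
    ext z
    refine ⟨fun hz => ⟨hz.1, fun hzU => hz.2 ?_⟩, fun hz => ⟨hz.1, fun hzΩ => hz.2 ?_⟩⟩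
    · rw [h]; exact ⟨hzU, hΩ.front_subset_closedHalf hz⟩
    · rw [h] at hzΩ; exact hzΩ.1
  rw [this]
  exact isClosed_closure.sdiff hU

/-- A local description of the domain as a sublevel set `{g < 0}` on `W`, where `g` increases
strictly in the spatial direction `e`. -/
structure IsChart (Ω W : Set (SpaceTime d)) (g : SpaceTime d → ℝ) (e : Space d) : Prop where
  isOpen : IsOpen W
  contDiffOn : ContDiffOn ℝ 1 g W
  pos : ∀ y ∈ W, 0 < fderiv ℝ g y (0, e)
  mem_iff : ∀ y ∈ W ∩ closedHalf d, (y ∈ Ω ↔ g y < 0)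

theorem IsMovingDomain.exists_chart (hΩ : IsMovingDomain Ω) (hz : z ∈ front Ω) :
    ∃ W g e, z ∈ W ∧ IsChart Ω W g e := by
  obtain ⟨W, g, hW, hzW, hg, ⟨e, he⟩, hmem⟩ := hΩ.boundary z hz
  obtain ⟨e, he⟩ : ∃ e : Space d, 0 < fderiv ℝ g z (0, e) := by
    rcases lt_or_gt_of_ne he with h | h
    · refine ⟨-e, ?_⟩
      have : ((0 : ℝ), -e) = -((0 : ℝ), e) := by simp
      rw [this, map_neg]
      exact neg_pos.2 h
    · exact ⟨e, h⟩
  have hcont : ContinuousOn (fun y => fderiv ℝ g y (0, e)) W :=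
    (hg.continuousOn_fderiv_of_isOpen hW le_rfl).clm_apply continuousOn_const
  refine ⟨W ∩ (fun y => fderiv ℝ g y (0, e)) ⁻¹' Ioi 0, g, e, ⟨hzW, he⟩,
    hcont.isOpen_inter_preimage hW isOpen_Ioi, hg.mono inter_subset_left, fun y hy => hy.2,
    fun y hy => hmem y ⟨hy.1.1, hy.2⟩⟩

namespace IsChart

theorem differentiableAt (h : IsChart Ω W g e) (hz : z ∈ W) : DifferentiableAt ℝ g z :=
  (h.contDiffOn.contDiffAt (h.isOpen.mem_nhds hz)).differentiableAt one_ne_zero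

theorem continuousOn_fderiv (h : IsChart Ω W g e) : ContinuousOn (fderiv ℝ g) W :=
  h.contDiffOn.continuousOn_fderiv_of_isOpen h.isOpen le_rfl

/-- Along a direction of increase, a point leaves its level set. -/
theorem eventually_sign (h : IsChart Ω W g e) (hz : z ∈ W) {v : SpaceTime d}
    (hv : 0 < fderiv ℝ g z v) :
    ∀ᶠ s in 𝓝 (0 : ℝ), SignType.sign (g (z + s • v) - g z) = SignType.sign s := by
  have hd : HasDerivAt (fun s : ℝ => g (z + s • v) - g z) (fderiv ℝ g z v) 0 := by
    have h1 : HasDerivAt (fun s : ℝ => z + s • v) v 0 := by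
      simpa using ((hasDerivAt_id (0 : ℝ)).smul_const v).const_add z
    have h2 : HasFDerivAt g (fderiv ℝ g z) (z + (0 : ℝ) • v) := by
      simpa using (h.differentiableAt hz).hasFDerivAt
    exact (h2.comp_hasDerivAt (0 : ℝ) h1).sub_const _
  have := eventually_nhdsWithin_sign_eq_of_deriv_pos (f := fun s : ℝ => g (z + s • v) - g z)
    (x₀ := 0) (by rw [hd.deriv]; exact hv) (by simp)
  simpa using this

theorem tendsto_ray (z v : SpaceTime d) :
    Filter.Tendsto (fun s : ℝ => z + s • v) (𝓝 0) (𝓝 z) := by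
  have : Continuous fun s : ℝ => z + s • v := by fun_prop
  simpa using this.tendsto 0

/-- A zero of `g` is reached from `{g < 0}` by moving in the direction `-e`, which is purely spatial
and therefore allowed at `t = 0` as well. Conversely `g ≤ 0` holds on the closure and `g ≥ 0` off
`Ω`. -/
theorem mem_front_iff (hΩ : IsMovingDomain Ω) (h : IsChart Ω W g e) (hz : z ∈ W)
    (hzH : z ∈ closedHalf d) : z ∈ front Ω ↔ g z = 0 := by
  constructor
  · intro hf
    have h1 : 0 ≤ g z := not_lt.1 fun h' => hf.2 ((h.mem_iff z ⟨hz, hzH⟩).2 h')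
    have h2 : z ∈ closure (Ω ∩ W) := by
      rw [inter_comm]
      exact h.isOpen.inter_closure ⟨hz, hf.1⟩
    have h3 : g z ≤ 0 := by
      have : Filter.NeBot (𝓝[Ω ∩ W] z) := mem_closure_iff_nhdsWithin_neBot.1 h2
      refine le_of_tendsto ((h.differentiableAt hz).continuousAt.tendsto.mono_left
        (nhdsWithin_le_nhds (s := Ω ∩ W))) ?_
      filter_upwards [self_mem_nhdsWithin] with y hy
      exact ((h.mem_iff y ⟨hy.2, hΩ.subset_closedHalf hy.1⟩).1 hy.1).le
    exact le_antisymm h3 h1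
  · intro h0
    refine ⟨?_, fun hzΩ => (((h.mem_iff z ⟨hz, hzH⟩).1 hzΩ).ne h0)⟩
    have hev := (h.eventually_sign hz (h.pos z hz)).filter_mono
      (nhdsWithin_le_nhds (s := Iio (0 : ℝ)))
    refine mem_closure_of_tendsto ((tendsto_ray z (0, e)).mono_left
      (nhdsWithin_le_nhds (s := Iio (0 : ℝ)))) ?_
    filter_upwards [hev, self_mem_nhdsWithin, ((tendsto_ray z (0, e)).eventually
      (h.isOpen.mem_nhds hz)).filter_mono nhdsWithin_le_nhds] with s hs (hs0 : s < 0) hsW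
    rw [h.mem_iff _ ⟨hsW, by simpa [closedHalf] using hzH⟩]
    rw [sign_neg hs0, sign_eq_neg_one_iff, h0, sub_zero] at hs
    exact hs

/-- Near a point of the front, the front is a graph over the planes spanned by `(1, w)` and
`(0, e)`. -/
theorem exists_curve (h : IsChart Ω W g e) (hz : z ∈ W) (h0 : g z = 0) (w : Space d) :
    ∃ r : ℝ → ℝ, ContDiffAt ℝ 1 r z.1 ∧ r z.1 = 0 ∧
      ∀ᶠ s in 𝓝 z.1, g (s, z.2 + (s - z.1) • w + r s • e) = 0 := by
  -- The implicit function theorem is applied to `g ∘ m`, whose second partial derivative at `(z.1,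
  -- 0)` is `∂_e g > 0`. As `W` is open in full space-time, the curve also exists for times slightly
  -- before `z.1`, even if `z.1 = 0`.
  set m : ℝ × ℝ → SpaceTime d := fun p => (p.1, z.2 + (p.1 - z.1) • w + p.2 • e) with hm
  have hmz : m (z.1, 0) = z := by simp [hm]
  have hmC : ContDiff ℝ 1 m := by fun_prop
  have hG : ContDiffAt ℝ 1 (g ∘ m) (z.1, 0) := by
    refine ContDiffAt.comp _ ?_ hmC.contDiffAt
    rw [hmz]
    exact h.contDiffOn.contDiffAt (h.isOpen.mem_nhds hz)
  set a := fderiv ℝ g z (0, e) with ha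
  have hline : HasDerivAt (fun s : ℝ => (g ∘ m) (z.1, s)) a 0 := by
    have h1 : HasDerivAt (fun s : ℝ => m (z.1, s)) (0, e) 0 := by
      have : (fun s : ℝ => m (z.1, s)) = fun s : ℝ => z + s • ((0, e) : SpaceTime d) := by
        ext s <;> simp [hm]
      rw [this]
      simpa using ((hasDerivAt_id (0 : ℝ)).smul_const ((0, e) : SpaceTime d)).const_add z
    have h2 : HasFDerivAt g (fderiv ℝ g z) (m (z.1, 0)) := by
      rw [hmz]; exact (h.differentiableAt hz).hasFDerivAt
    exact h2.comp_hasDerivAt (0 : ℝ) h1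
  have hval : (fderiv ℝ (g ∘ m) (z.1, 0) ∘L .inr ℝ ℝ ℝ) 1 = a := by
    have h1 : HasDerivAt (fun s : ℝ => (z.1, s)) ((0 : ℝ), (1 : ℝ)) 0 :=
      (hasDerivAt_const _ _).prodMk (hasDerivAt_id _)
    have h2 := (hG.differentiableAt one_ne_zero).hasFDerivAt.comp_hasDerivAt (0 : ℝ) h1
    simpa using h2.unique hline
  have hinv : (fderiv ℝ (g ∘ m) (z.1, 0) ∘L .inr ℝ ℝ ℝ).IsInvertible := by
    refine ⟨ContinuousLinearEquiv.unitsEquivAut ℝ (Units.mk0 a (h.pos z hz).ne'), ?_⟩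
    ext
    rw [hval]
    simp
  refine ⟨hG.implicitFunction one_ne_zero hinv, hG.contDiffAt_implicitFunction one_ne_zero hinv,
    hG.implicitFunction_apply_self one_ne_zero hinv, ?_⟩
  filter_upwards [hG.eventually_apply_implicitFunction one_ne_zero hinv] with s hs
  rw [Function.comp_apply, Function.comp_apply, hmz, h0] at hs
  exact hs

/-- The gas region lies on the side `{g < 0}` of the front. -/
theorem density_eq_zero (h : IsChart Ω W g e) (hA : 0 < A) (hγ : 1 < γ)
    (hρ : ∀ z ∈ closedHalf d, 0 ≤ ρ z) (hgas : IsGasRegion Ω ρ) (hN : IsOpen N)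
    (hc : ContinuousOn (fun z => soundSpeed A γ (ρ z)) (N ∩ closedHalf d)) (hzW : z ∈ W)
    (hzN : z ∈ N) (hzH : z ∈ closedHalf d) (h0 : 0 ≤ g z) : ρ z = 0 := by
  -- On this open set the density vanishes almost everywhere, hence `c` vanishes everywhere by
  -- continuity. It remains to reach `z` from `G`.
  set G : Set (SpaceTime d) := (W ∩ g ⁻¹' Ioi 0) ∩ (N ∩ openHalf d) with hG
  have hGo : IsOpen G := (h.contDiffOn.continuousOn.isOpen_inter_preimage h.isOpen isOpen_Ioi).inter
    (hN.inter isOpen_openHalf)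
  have hGc : EqOn (fun z => soundSpeed A γ (ρ z)) (fun _ => 0) G := by
    refine Measure.eqOn_open_of_ae_eq (μ := volume) ?_ hGo
      (hc.mono fun y hy => ⟨hy.2.1, openHalf_subset_closedHalf hy.2.2⟩) continuousOn_const
    have h1 := hgas.vacuum_outside
    rw [ae_restrict_iff' isOpen_openHalf.measurableSet] at h1
    rw [Filter.EventuallyEq, ae_restrict_iff' hGo.measurableSet]
    filter_upwards [h1] with y hy hyG
    have hyΩ : y ∉ Ω := fun h' =>
      ((h.mem_iff y ⟨hyG.1.1, openHalf_subset_closedHalf hyG.2.2⟩).1 h').not_gt hyG.1.2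
    rw [hy hyG.2.2 hyΩ, soundSpeed_zero hγ]
  -- Tilting `e` slightly forward in time keeps `g` increasing and makes the ray enter `t > 0` even
  -- when `z.1 = 0`.
  obtain ⟨δ, hδ, hδv⟩ : ∃ δ : ℝ, 0 < δ ∧ 0 < fderiv ℝ g z (δ, e) := by
    have hct : Continuous fun δ : ℝ => fderiv ℝ g z (δ, e) := by fun_prop
    have hev : ∀ᶠ δ in 𝓝 (0 : ℝ), 0 < fderiv ℝ g z (δ, e) :=
      hct.continuousAt.eventually (lt_mem_nhds (h.pos z hzW))
    obtain ⟨δ, h1, h2⟩ := ((hev.filter_mono (nhdsWithin_le_nhds (s := Ioi (0 : ℝ)))).and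
      self_mem_nhdsWithin).exists
    exact ⟨δ, h2, h1⟩
  have hcl : z ∈ closure G := by
    refine mem_closure_of_tendsto ((tendsto_ray z (δ, e)).mono_left
      (nhdsWithin_le_nhds (s := Ioi (0 : ℝ)))) ?_
    filter_upwards [(h.eventually_sign hzW hδv).filter_mono nhdsWithin_le_nhds,
      self_mem_nhdsWithin, ((tendsto_ray z (δ, e)).eventually
      ((h.isOpen.inter hN).mem_nhds ⟨hzW, hzN⟩)).filter_mono nhdsWithin_le_nhds]
      with s hs (hs0 : 0 < s) hsW
    rw [sign_pos hs0, sign_eq_one_iff] at hs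
    refine ⟨⟨hsW.1, ?_⟩, hsW.2, ?_⟩
    · simp only [mem_preimage, mem_Ioi]; linarith
    · have : 0 ≤ z.1 := hzH
      simp only [openHalf, mem_ofPred_eq, Prod.fst_add, Prod.smul_fst, smul_eq_mul]
      positivity
  have hNeBot : Filter.NeBot (𝓝[G] z) := mem_closure_iff_nhdsWithin_neBot.1 hcl
  have hlim := ((hc z ⟨hzN, hzH⟩).mono (t := N ∩ closedHalf d) subset_rfl).tendsto.mono_left
    (nhdsWithin_mono z (fun y hy => ⟨hy.2.1, openHalf_subset_closedHalf hy.2.2⟩ :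
      G ⊆ N ∩ closedHalf d))
  have hlim0 : Filter.Tendsto (fun z => soundSpeed A γ (ρ z)) (𝓝[G] z) (𝓝 0) :=
    tendsto_const_nhds.congr' (by
      filter_upwards [self_mem_nhdsWithin] with y hy
      exact (hGc hy).symm)
  exact (soundSpeed_eq_zero_iff hA hγ (hρ z hzH)).1 (tendsto_nhds_unique hlim hlim0)

end IsChart

/-- Every point of the front is a limit of points, at positive times, where there is gas. -/
theorem IsGasRegion.exists_pos (hgas : IsGasRegion Ω ρ) (hρ : ∀ z ∈ closedHalf d, 0 ≤ ρ z)
    (hz : z ∈ front Ω) {V : Set (SpaceTime d)} (hV : V ∈ 𝓝 z) :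
    ∃ y ∈ V, y ∈ openHalf d ∧ 0 < ρ y := by
  by_contra! hcon
  refine hgas.front_subset_support z hz (interior V) (interior_mem_nhds.2 hV) ?_
  refine ae_restrict_of_forall_mem (isOpen_interior.inter isOpen_openHalf).measurableSet ?_
  exact fun y hy => le_antisymm (hcon y (interior_subset hy.1) hy.2)
    (hρ y (openHalf_subset_closedHalf hy.2))

end

/-! ### The front moves with the gas and without acceleration. -/

section

variable {d : ℕ} {A γ : ℝ} {ρ : SpaceTime d → ℝ} {u : SpaceTime d → Space d}
  {Ω W N : Set (SpaceTime d)} {g : SpaceTime d → ℝ} {e : Space d} {z : SpaceTime d}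

/-- An admissible flow with vacuum outside of `Ω`, such that `(c, u)` is of class `C¹` in the
neighborhood `N` of the front. -/
structure IsRegularFlow (A γ : ℝ) (Ω N : Set (SpaceTime d)) (ρ : SpaceTime d → ℝ)
    (u : SpaceTime d → Space d) : Prop where
  hA : 0 < A
  hγ : 1 < γ
  sol : IsAdmissibleSolution A γ ρ u
  dom : IsMovingDomain Ω
  gas : IsGasRegion Ω ρ
  isOpen : IsOpen N
  front_subset : front Ω ⊆ N
  sound : ContDiffOn ℝ 1 (fun z => soundSpeed A γ (ρ z)) (N ∩ closedHalf d)
  velocity : ContDiffOn ℝ 1 u (N ∩ closedHalf d)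

/-- The squared Euclidean distance to `z` in space-time. -/
noncomputable def sqDist (z y : SpaceTime d) : ℝ := (y.1 - z.1) ^ 2 + ‖y.2 - z.2‖ ^ 2

theorem contDiff_sqDist (z : SpaceTime d) : ContDiff ℝ ∞ (sqDist z) :=
  ((contDiff_fst.sub contDiff_const).pow 2).add ((contDiff_snd.sub contDiff_const).norm_sq ℝ)

theorem sqDist_nonneg (z y : SpaceTime d) : 0 ≤ sqDist z y := by
  unfold sqDist; positivity

theorem sqDist_self (z : SpaceTime d) : sqDist z z = 0 := by simp [sqDist]

/-- The norm of the product space is a maximum and is not smooth; this comparison lets `sqDist`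
serve as a smooth substitute. -/
theorem dist_le_of_sqDist_le {z y : SpaceTime d} {r : ℝ} (hr : 0 ≤ r) (h : sqDist z y ≤ r ^ 2) :
    dist y z ≤ r := by
  unfold sqDist at h
  rw [dist_eq_norm, Prod.norm_def, max_le_iff]
  constructor
  · rw [Real.norm_eq_abs]
    exact abs_le_of_sq_le_sq (by simp only [Prod.fst_sub]; nlinarith [sq_nonneg ‖y.2 - z.2‖]) hr
  · exact (abs_le_of_sq_le_sq' (by simp only [Prod.snd_sub]; nlinarith [sq_nonneg (y.1 - z.1)])
      hr).2

theorem fderiv_sqDist_self (z : SpaceTime d) : fderiv ℝ (sqDist z) z = 0 := by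
  refine IsLocalMin.fderiv_eq_zero (Filter.Eventually.of_forall fun y => ?_)
  rw [sqDist_self]; exact sqDist_nonneg z y

namespace IsRegularFlow

theorem isOpen_pos (hF : IsRegularFlow A γ Ω N ρ u) :
    IsOpen {z | z ∈ N ∩ openHalf d ∧ 0 < ρ z} := by
  have h := (hF.sound.continuousOn.mono (inter_subset_inter_right N
    openHalf_subset_closedHalf)).isOpen_inter_preimage (hF.isOpen.inter isOpen_openHalf)
    (isOpen_ne (x := (0 : ℝ)))
  convert! h using 1
  ext z
  simp only [mem_ofPred_eq, mem_inter_iff, mem_preimage]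
  refine and_congr_right fun hz => ?_
  have h0 := hF.sol.density_nonneg z (openHalf_subset_closedHalf hz.2)
  rw [Ne, soundSpeed_eq_zero_iff hF.hA hF.hγ h0]
  exact ⟨fun h => h.ne', fun h => lt_of_le_of_ne h0 (Ne.symm h)⟩

theorem transport (hF : IsRegularFlow A γ Ω N ρ u)
    (hzN : z ∈ N) (hz : z ∈ openHalf d) (hρ : 0 < ρ z) :
    fderiv ℝ (fun z => soundSpeed A γ (ρ z)) z (1, u z)
      = -((γ - 1) / 2 * soundSpeed A γ (ρ z) * divergence u z) := by
  have hsub : {z | z ∈ N ∩ openHalf d ∧ 0 < ρ z} ⊆ N ∩ closedHalf d :=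
    fun y hy => ⟨hy.1.1, openHalf_subset_closedHalf hy.1.2⟩
  exact hF.sol.soundSpeed_transport hF.hA hF.hγ hF.isOpen_pos (fun y hy => hy.1.2)
    (fun y hy => hy.2) (hF.sound.mono hsub) (hF.velocity.mono hsub) ⟨⟨hzN, hz⟩, hρ⟩

theorem acceleration (hF : IsRegularFlow A γ Ω N ρ u)
    (hzN : z ∈ N) (hz : z ∈ openHalf d) (hρ : 0 < ρ z) (i : Fin d) :
    fderiv ℝ u z (1, u z) i
      = -(2 / (γ - 1)) * (soundSpeed A γ (ρ z) *
        fderiv ℝ (fun z => soundSpeed A γ (ρ z)) z (0, EuclideanSpace.single i 1)) := by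
  have hsub : {z | z ∈ N ∩ openHalf d ∧ 0 < ρ z} ⊆ N ∩ closedHalf d :=
    fun y hy => ⟨hy.1.1, openHalf_subset_closedHalf hy.1.2⟩
  exact hF.sol.acceleration_eq hF.hA hF.hγ hF.isOpen_pos (fun y hy => hy.1.2)
    (fun y hy => hy.2) (hF.sound.mono hsub) (hF.velocity.mono hsub) ⟨⟨hzN, hz⟩, hρ⟩ i

/-- At positive times the front moves with the gas: a maximum principle shows that gas cannot
cross it. -/
theorem tangent_of_pos (hF : IsRegularFlow A γ Ω N ρ u)
    (h : IsChart Ω W g e) (hzW : z ∈ W) (hz : z ∈ front Ω) (hz0 : 0 < z.1) :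
    fderiv ℝ g z (1, u z) = 0 := by
  by_contra hL
  -- Both signs of the normal flux are treated at once: the contradiction comes from an equation at
  -- a critical point, which is insensitive to the direction of crossing.
  obtain ⟨σ, hσ, hσL⟩ : ∃ σ : ℝ, |σ| = 1 ∧ 0 < σ * fderiv ℝ g z (1, u z) := by
    rcases lt_or_gt_of_ne hL with hneg | hpos
    · exact ⟨-1, by simp, by linarith⟩
    · exact ⟨1, by simp, by linarith⟩
  set l := σ * fderiv ℝ g z (1, u z) with hl
  set G : Set (SpaceTime d) := W ∩ (N ∩ openHalf d) with hG
  have hGo : IsOpen G := h.isOpen.inter (hF.isOpen.inter isOpen_openHalf)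
  have hzG : z ∈ G := ⟨hzW, hF.front_subset hz, hz0⟩
  have hsub : G ⊆ N ∩ closedHalf d := fun y hy => ⟨hy.2.1, openHalf_subset_closedHalf hy.2.2⟩
  have hu : ContDiffOn ℝ 1 u G := hF.velocity.mono hsub
  have hc : ContDiffOn ℝ 1 (fun z => soundSpeed A γ (ρ z)) G := hF.sound.mono hsub
  have hdiv : ContinuousOn (divergence u) G := by
    refine continuousOn_finsetSum _ fun j _ => ?_
    exact (EuclideanSpace.proj (𝕜 := ℝ) j).continuous.comp_continuousOn
      ((hu.continuousOn_fderiv_of_isOpen hGo le_rfl).clm_apply continuousOn_const)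
  -- The quadratic correction does not change the derivative at `z`, but confines `{g ≤ 0, β ≥ -η}`
  -- to the set `sqDist z ≤ η`.
  set β : SpaceTime d → ℝ := fun y => g y - sqDist z y with hβ
  have hβC : ContDiffOn ℝ 1 β G :=
    (h.contDiffOn.mono inter_subset_left).sub ((contDiff_sqDist z).of_le (by simp)).contDiffOn
  have hβL : ContinuousOn (fun y => σ * fderiv ℝ β y (1, u y)) G :=
    continuousOn_const.mul ((hβC.continuousOn_fderiv_of_isOpen hGo le_rfl).clm_apply
      (continuousOn_const.prodMk hu.continuousOn))
  have hβz : σ * fderiv ℝ β z (1, u z) = l := by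
    have : fderiv ℝ β z = fderiv ℝ g z := by
      rw [hβ, fderiv_fun_sub (h.differentiableAt hzW)
        ((contDiff_sqDist z).differentiable (by simp) z), fderiv_sqDist_self, sub_zero]
    rw [this]
  set K := |(γ - 1) / 2 * divergence u z| + 1 with hK
  have hKpos : 0 < K := by positivity
  have hev : ∀ᶠ y in 𝓝 z, y ∈ G ∧ l / 2 < σ * fderiv ℝ β y (1, u y) ∧
      |(γ - 1) / 2 * divergence u y| < K := by
    have hGn := hGo.mem_nhds hzG
    refine Filter.Eventually.and hGn (Filter.Eventually.and ?_ ?_)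
    · refine (hβL.continuousAt hGn).eventually (lt_mem_nhds ?_)
      show l / 2 < σ * fderiv ℝ β z (1, u z)
      rw [hβz]; linarith
    · refine ((continuousOn_const.mul hdiv).continuousAt hGn).abs.eventually (gt_mem_nhds ?_)
      show |(γ - 1) / 2 * divergence u z| < K
      rw [hK]; linarith
  obtain ⟨r, hr, hball⟩ := Metric.eventually_nhds_iff.1 hev
  have hball' : ∀ y, sqDist z y ≤ (r / 2) ^ 2 → y ∈ G ∧ l / 2 < σ * fderiv ℝ β y (1, u y) ∧
      |(γ - 1) / 2 * divergence u y| < K := fun y hy =>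
    hball (lt_of_le_of_lt (dist_le_of_sqDist_le (by positivity) hy) (by linarith))
  -- The first bound keeps the maximum away from the edge of the ball; the second makes the
  -- zeroth-order term `K η` too small to balance the flux, which exceeds `l / 2`.
  obtain ⟨η, hη, hηr, hηK⟩ : ∃ η : ℝ, 0 < η ∧ η < (r / 2) ^ 2 ∧ K * η < l / 2 := by
    refine ⟨min ((r / 2) ^ 2 / 2) (l / (4 * K)), by positivity, ?_, ?_⟩
    · refine lt_of_le_of_lt (min_le_left _ _) ?_
      have : 0 < (r / 2) ^ 2 := by positivity
      linarith
    · calc K * min ((r / 2) ^ 2 / 2) (l / (4 * K)) ≤ K * (l / (4 * K)) := by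
            gcongr; exact min_le_right _ _
        _ = l / 4 := by field_simp
        _ < l / 2 := by linarith
  have hqc : Continuous (sqDist z) := (contDiff_sqDist z).continuous
  set B : Set (SpaceTime d) := {y | sqDist z y ≤ (r / 2) ^ 2} with hB
  have hBc : IsCompact B := by
    refine Metric.isCompact_of_isClosed_isBounded (isClosed_le hqc continuous_const) ?_
    exact Metric.isBounded_closedBall.subset fun y hy =>
      dist_le_of_sqDist_le (r := r / 2) (by positivity) hy
  have hBG : B ⊆ G := fun y hy => (hball' y hy).1
  set Q : Set (SpaceTime d) := B ∩ (fun y => (g y, β y)) ⁻¹' (Iic 0 ×ˢ Ici (-η)) with hQ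
  have hgβ : ContinuousOn (fun y => (g y, β y)) G :=
    (h.contDiffOn.continuousOn.mono inter_subset_left).prodMk hβC.continuousOn
  have hQc : IsCompact Q := hBc.of_isClosed_subset
    ((hgβ.mono hBG).preimage_isClosed_of_isClosed hBc.isClosed (isClosed_Iic.prod isClosed_Ici))
    inter_subset_left
  -- This product vanishes on `{g = 0}`, because `c` does, and on `{β = -η}`. Its maximum over `Q`
  -- is positive since there is gas arbitrarily close to `z`, so it is attained in the interior.
  set f : SpaceTime d → ℝ := fun y => soundSpeed A γ (ρ y) * (β y + η) with hf
  have hfC : ContDiffOn ℝ 1 f G := hc.mul (hβC.add contDiffOn_const)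
  have hg0 : g z = 0 := (h.mem_front_iff hF.dom hzW hz0.le).1 hz
  have hneg : ∀ y ∈ G, 0 < ρ y → g y < 0 := by
    intro y hy hρ
    by_contra! hcon
    exact hρ.ne' (h.density_eq_zero hF.hA hF.hγ hF.sol.density_nonneg hF.gas hF.isOpen
      hF.sound.continuousOn hy.1 hy.2.1 (openHalf_subset_closedHalf hy.2.2) hcon)
  obtain ⟨y₁, hy₁, -, hρ₁⟩ := hF.gas.exists_pos hF.sol.density_nonneg hz
    (V := {y | y ∈ G ∧ sqDist z y ≤ (r / 2) ^ 2 ∧ -η < β y}) (by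
      refine Filter.inter_mem (hGo.mem_nhds hzG) (Filter.inter_mem ?_ ?_)
      · exact hqc.continuousAt.eventually (ge_mem_nhds (by rw [sqDist_self]; positivity))
      · refine (hβC.continuousOn.continuousAt (hGo.mem_nhds hzG)).eventually (lt_mem_nhds ?_)
        simp [hβ, hg0, sqDist_self, hη])
  have hQ₁ : y₁ ∈ Q := ⟨hy₁.2.1, (hneg y₁ hy₁.1 hρ₁).le, hy₁.2.2.le⟩
  obtain ⟨y, hyQ, hymax⟩ := hQc.exists_isMaxOn ⟨y₁, hQ₁⟩
    (hfC.continuousOn.mono (inter_subset_left.trans hBG))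
  have hfy : 0 < f y := lt_of_lt_of_le (mul_pos (soundSpeed_pos hF.hA hF.hγ hρ₁)
    (by linarith [hy₁.2.2])) (hymax hQ₁)
  have hyG : y ∈ G := hBG hyQ.1
  have hyc : 0 ≤ soundSpeed A γ (ρ y) :=
    soundSpeed_nonneg (hF.sol.density_nonneg y (openHalf_subset_closedHalf hyG.2.2))
  have hyβ : 0 < β y + η := pos_of_mul_pos_right hfy hyc
  have hyc' : 0 < soundSpeed A γ (ρ y) := pos_of_mul_pos_left hfy hyβ.le
  have hyρ : 0 < ρ y := by
    refine lt_of_le_of_ne (hF.sol.density_nonneg y (openHalf_subset_closedHalf hyG.2.2)) ?_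
    intro h0
    rw [← h0, soundSpeed_zero hF.hγ] at hyc'
    exact lt_irrefl _ hyc'
  have hyg : g y < 0 := hneg y hyG hyρ
  have hyq : sqDist z y < (r / 2) ^ 2 := by
    have : 0 < g y - sqDist z y + η := hyβ
    linarith
  have hloc : IsLocalMax f y := by
    have hGn := hGo.mem_nhds hyG
    filter_upwards [hGn, hqc.continuousAt.eventually (gt_mem_nhds hyq),
      (hβC.continuousOn.continuousAt hGn).eventually (lt_mem_nhds (neg_lt_iff_pos_add.2 hyβ)),
      (h.differentiableAt hyG.1).continuousAt.eventually (gt_mem_nhds hyg)] with x hxG h1 h2 h3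
    exact hymax ⟨h1.le, h3.le, h2.le⟩
  have hdc := (hc.contDiffAt (hGo.mem_nhds hyG)).differentiableAt one_ne_zero
  have hdβ := (hβC.contDiffAt (hGo.mem_nhds hyG)).differentiableAt one_ne_zero
  have hD := congrArg (fun L => L (1, u y)) hloc.fderiv_eq_zero
  rw [hf, fderiv_fun_mul hdc (hdβ.add_const η), fderiv_add_const] at hD
  simp only [add_apply, smul_apply, smul_eq_mul, zero_apply] at hD
  rw [hF.transport hyG.2.1 hyG.2.2 hyρ] at hD
  -- Differentiating `c (β + η)` along `(1, u)` at the maximum and inserting the transport equation,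
  -- every term carries a factor `c > 0`, which cancels.
  have hD' : fderiv ℝ β y (1, u y) - (β y + η) * ((γ - 1) / 2 * divergence u y) = 0 := by
    apply mul_left_cancel₀ hyc'.ne'
    linear_combination hD
  obtain ⟨-, hβy, hKy⟩ := hball' y hyQ.1
  have hyβ2 : β y + η ≤ η := by
    have := sqDist_nonneg z y
    have : β y = g y - sqDist z y := rfl
    linarith
  have : σ * fderiv ℝ β y (1, u y) ≤ K * η := by
    calc σ * fderiv ℝ β y (1, u y) = σ * ((β y + η) * ((γ - 1) / 2 * divergence u y)) := by
          rw [sub_eq_zero.1 hD']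
      _ ≤ |σ * ((β y + η) * ((γ - 1) / 2 * divergence u y))| := le_abs_self _
      _ = (β y + η) * |(γ - 1) / 2 * divergence u y| := by
          rw [abs_mul, hσ, one_mul, abs_mul, abs_of_pos hyβ]
      _ ≤ η * K := mul_le_mul hyβ2 hKy.le (abs_nonneg _) hη.le
      _ = K * η := mul_comm _ _
  linarith

/-- The space-time velocity `(1, u)` is tangent to the front. -/
theorem tangent (hF : IsRegularFlow A γ Ω N ρ u)
    (h : IsChart Ω W g e) (hzW : z ∈ W) (hz : z ∈ front Ω) :
    fderiv ℝ g z (1, u z) = 0 := by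
  have hzH := hF.dom.front_subset_closedHalf hz
  have hg0 : g z = 0 := (h.mem_front_iff hF.dom hzW hzH).1 hz
  -- A curve inside the front reaches `z` from later, hence positive, times; the tangency known
  -- there passes to the limit, which covers `t = 0`.
  obtain ⟨r, hr, hrz, hcurve⟩ := h.exists_curve hzW hg0 0
  set Y : ℝ → SpaceTime d := fun s => (s, z.2 + (s - z.1) • (0 : Space d) + r s • e) with hY
  have hYc : ContinuousAt Y z.1 := by
    have := hr.continuousAt
    fun_prop
  have hYz : Y z.1 = z := by simp [hY, hrz]
  have hmem : ∀ᶠ s in 𝓝[>] z.1, Y s ∈ (W ∩ N ∩ closedHalf d) ∧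
      fderiv ℝ g (Y s) (1, u (Y s)) = 0 := by
    have h1 : ∀ᶠ s in 𝓝 z.1, Y s ∈ W ∩ N := hYc.eventually (by
      rw [hYz]; exact (h.isOpen.inter hF.isOpen).mem_nhds ⟨hzW, hF.front_subset hz⟩)
    filter_upwards [h1.filter_mono nhdsWithin_le_nhds, hcurve.filter_mono nhdsWithin_le_nhds,
      self_mem_nhdsWithin] with s hs hs0 (hsz : z.1 < s)
    have hspos : 0 < (Y s).1 := lt_of_le_of_lt (show 0 ≤ z.1 from hzH) hsz
    have hsf : Y s ∈ front Ω := (h.mem_front_iff hF.dom hs.1 hspos.le).2 hs0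
    exact ⟨⟨hs, hspos.le⟩, hF.tangent_of_pos h hs.1 hsf hspos⟩
  have hL : ContinuousOn (fun y => fderiv ℝ g y (1, u y)) (W ∩ N ∩ closedHalf d) :=
    (h.continuousOn_fderiv.mono fun y hy => hy.1.1).clm_apply
      (continuousOn_const.prodMk (hF.velocity.continuousOn.mono fun y hy => ⟨hy.1.2, hy.2⟩))
  have hlim := (hL z ⟨⟨hzW, hF.front_subset hz⟩, hzH⟩).tendsto.comp
    (tendsto_nhdsWithin_iff.2 ⟨(by
      have := hYc.tendsto
      rw [hYz] at this
      exact this.mono_left nhdsWithin_le_nhds : Filter.Tendsto Y (𝓝[>] z.1) (𝓝 z)),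
      hmem.mono fun s hs => hs.1⟩)
  exact tendsto_nhds_unique hlim (tendsto_const_nhds.congr' (hmem.mono fun s hs => hs.2.symm))

/-- The front consists of vacuum. -/
theorem soundSpeed_front (hF : IsRegularFlow A γ Ω N ρ u) (hz : z ∈ front Ω) :
    soundSpeed A γ (ρ z) = 0 := by
  have hzH := hF.dom.front_subset_closedHalf hz
  obtain ⟨W, g, e, hzW, h⟩ := hF.dom.exists_chart hz
  rw [h.density_eq_zero hF.hA hF.hγ hF.sol.density_nonneg hF.gas hF.isOpen
    hF.sound.continuousOn hzW (hF.front_subset hz) hzH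
    ((h.mem_front_iff hF.dom hzW hzH).1 hz).ge, soundSpeed_zero hF.hγ]

/-- The gas is not accelerated at the front. -/
theorem acceleration_front (hF : IsRegularFlow A γ Ω N ρ u) (hz : z ∈ front Ω) :
    fderivWithin ℝ u (N ∩ closedHalf d) z (1, u z) = 0 := by
  have hzH := hF.dom.front_subset_closedHalf hz
  have hzN := hF.front_subset hz
  have hUD := uniqueDiffOn_inter_closedHalf hF.isOpen
  set P : Set (SpaceTime d) := {y | y ∈ N ∩ openHalf d ∧ 0 < ρ y} with hP
  have hPsub : P ⊆ N ∩ closedHalf d := fun y hy => ⟨hy.1.1, openHalf_subset_closedHalf hy.1.2⟩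
  -- The acceleration law holds on `P`. Both of its sides are continuous up to `z`, and the
  -- right-hand side contains the factor `c`, which is zero on the front.
  have hcl : z ∈ closure P := by
    rw [mem_closure_iff_nhds]
    intro V hV
    obtain ⟨y, hy, hyH, hyρ⟩ := hF.gas.exists_pos hF.sol.density_nonneg hz
      (Filter.inter_mem hV (hF.isOpen.mem_nhds hzN))
    exact ⟨y, hy.1, ⟨hy.2, hyH⟩, hyρ⟩
  have hNB : Filter.NeBot (𝓝[P] z) := mem_closure_iff_nhdsWithin_neBot.1 hcl
  ext i
  have h1 : ContinuousOn (fun y => fderivWithin ℝ u (N ∩ closedHalf d) y (1, u y) i)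
      (N ∩ closedHalf d) :=
    (EuclideanSpace.proj (𝕜 := ℝ) i).continuous.comp_continuousOn
      ((hF.velocity.continuousOn_fderivWithin hUD le_rfl).clm_apply
        (continuousOn_const.prodMk hF.velocity.continuousOn))
  have h2 : ContinuousOn (fun y => -(2 / (γ - 1)) * (soundSpeed A γ (ρ y) *
      fderivWithin ℝ (fun z => soundSpeed A γ (ρ z)) (N ∩ closedHalf d) y
        (0, EuclideanSpace.single i 1))) (N ∩ closedHalf d) :=
    continuousOn_const.mul (hF.sound.continuousOn.mul
      ((hF.sound.continuousOn_fderivWithin hUD le_rfl).clm_apply continuousOn_const))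
  have hz' : z ∈ N ∩ closedHalf d := ⟨hzN, hzH⟩
  have l1 := (h1 z hz').tendsto.mono_left (nhdsWithin_mono z hPsub)
  have l2 := (h2 z hz').tendsto.mono_left (nhdsWithin_mono z hPsub)
  have := tendsto_nhds_unique (l1.congr' (by
    filter_upwards [self_mem_nhdsWithin] with y hy
    have hyn : N ∩ closedHalf d ∈ 𝓝 y := Filter.mem_of_superset
      ((hF.isOpen.inter isOpen_openHalf).mem_nhds hy.1)
      (inter_subset_inter_right N openHalf_subset_closedHalf)
    rw [fderivWithin_of_mem_nhds hyn, fderivWithin_of_mem_nhds hyn,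
      hF.acceleration hy.1.1 hy.1.2 hy.2 i])) l2
  rw [this, hF.soundSpeed_front hz]
  simp

end IsRegularFlow

end

/-! ### Straight-line motion of the front. -/

section

section Gronwall

variable {E : Type*} [NormedAddCommGroup E] [NormedSpace ℝ E] {q q' : ℝ → E} {S : Set ℝ} {K a s : ℝ}

theorem eq_zero_of_norm_deriv_le_of_le (hS : S.OrdConnected)
    (hq : ∀ s ∈ S, HasDerivWithinAt q (q' s) S s) (hK : ∀ s ∈ S, ‖q' s‖ ≤ K * ‖q s‖)
    (ha : a ∈ S) (hs : s ∈ S) (h0 : q a = 0) (has : a ≤ s) : q s = 0 := by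
  have hsub : Icc a s ⊆ S := hS.out ha hs
  have h := norm_le_gronwallBound_of_norm_deriv_right_le (f := q) (f' := q') (δ := 0) (K := K)
    (ε := 0) (a := a) (b := s) (fun x hx => (hq x (hsub hx)).continuousWithinAt.mono hsub)
    (fun x hx => by
      refine (hq x (hsub ⟨hx.1, hx.2.le⟩)).mono_of_mem_nhdsWithin ?_
      refine Filter.mem_of_superset (Icc_mem_nhdsGE hx.2) fun y hy => hsub ⟨hx.1.trans hy.1, hy.2⟩)
    (by simp [h0]) (fun x hx => by simpa using hK x (hsub ⟨hx.1, hx.2.le⟩)) s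
    (right_mem_Icc.2 has)
  rw [gronwallBound_ε0_δ0] at h
  exact norm_le_zero_iff.1 h

/-- Uniqueness of the zero solution of a differential inequality `‖q'‖ ≤ K ‖q‖` on an interval. -/
theorem eq_zero_of_norm_deriv_le (hS : S.OrdConnected)
    (hq : ∀ s ∈ S, HasDerivWithinAt q (q' s) S s) (hK : ∀ s ∈ S, ‖q' s‖ ≤ K * ‖q s‖)
    (ha : a ∈ S) (hs : s ∈ S) (h0 : q a = 0) : q s = 0 := by
  rcases le_total a s with has | has
  · exact eq_zero_of_norm_deriv_le_of_le hS hq hK ha hs h0 has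
  · have hS' : (Neg.neg ⁻¹' S).OrdConnected := hS.preimage_anti fun _ _ h => neg_le_neg h
    have := eq_zero_of_norm_deriv_le_of_le (q := fun s => q (-s)) (q' := fun s => -q' (-s))
      (S := Neg.neg ⁻¹' S) (a := -a) (s := -s) (K := K) hS' (fun x hx => by
        have h1 := (hq (-x) hx).scomp x (hasDerivAt_neg x).hasDerivWithinAt
          (s := Neg.neg ⁻¹' S) fun y hy => hy
        rw [neg_one_smul] at h1
        exact h1) (fun x hx => by simpa using hK (-x) hx) (by simpa using ha)
      (by simpa using hs) (by simpa using h0) (by simpa using has)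
    simpa using this

end Gronwall

variable {d : ℕ} {A γ : ℝ} {ρ : SpaceTime d → ℝ} {u : SpaceTime d → Space d}
  {Ω W N : Set (SpaceTime d)} {g : SpaceTime d → ℝ} {e : Space d} {z : SpaceTime d}

namespace IsRegularFlow

/-- The motion of the front is locally uniform along straight lines. -/
theorem line_mem_front_local (hF : IsRegularFlow A γ Ω N ρ u) (hz : z ∈ front Ω) :
    ∃ δ > 0, ∀ s, 0 ≤ s → |s - z.1| < δ →
      (s, z.2 + (s - z.1) • u z) ∈ front Ω ∧ u (s, z.2 + (s - z.1) • u z) = u z := by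
  have hzH := hF.dom.front_subset_closedHalf hz
  have hzN := hF.front_subset hz
  have hzNH : z ∈ N ∩ closedHalf d := ⟨hzN, hzH⟩
  obtain ⟨W, g, e, hzW, h⟩ := hF.dom.exists_chart hz
  -- The curve in the front is written as the expected straight line plus a deviation `r s • e`; the
  -- goal is `r = 0`.
  obtain ⟨r, hr, hrz, hcurve⟩ := h.exists_curve hzW ((h.mem_front_iff hF.dom hzW hzH).1 hz) (u z)
  set Y : ℝ → SpaceTime d := fun s => (s, z.2 + (s - z.1) • u z + r s • e) with hY
  have hYc : Filter.Tendsto Y (𝓝 z.1) (𝓝 z) := by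
    have h1 : ContinuousAt Y z.1 := by
      have := hr.continuousAt
      fun_prop
    have h2 : Y z.1 = z := by simp [hY, hrz]
    rw [ContinuousAt, h2] at h1
    exact h1
  set a := fderiv ℝ g z (0, e) with ha
  have hapos : 0 < a := h.pos z hzW
  set D := fderivWithin ℝ u (N ∩ closedHalf d) with hD
  have hUD := uniqueDiffOn_inter_closedHalf hF.isOpen
  obtain ⟨C₁, hC₁⟩ : ∃ C₁, ∀ᶠ y in 𝓝 z, y ∈ closedHalf d → ‖D y‖ ≤ C₁ := by
    refine ⟨‖D z‖ + 1, ?_⟩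
    have h1 := ((hF.velocity.continuousOn_fderivWithin hUD le_rfl) z hzNH).norm.eventually
      (ge_mem_nhds (lt_add_one ‖D z‖))
    rw [eventually_nhdsWithin_iff] at h1
    filter_upwards [h1, hF.isOpen.mem_nhds hzN] with y hy hyN hyH using hy ⟨hyN, hyH⟩
  obtain ⟨C₂, hC₂⟩ : ∃ C₂, ∀ᶠ y in 𝓝 z, ‖fderiv ℝ g y‖ ≤ C₂ :=
    ⟨‖fderiv ℝ g z‖ + 1, ((h.continuousOn_fderiv.continuousAt
      (h.isOpen.mem_nhds hzW)).norm.eventually (ge_mem_nhds (lt_add_one _)))⟩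
  have hev : ∀ᶠ y in 𝓝 z, y ∈ W ∧ y ∈ N ∧ (y ∈ closedHalf d → ‖D y‖ ≤ C₁) ∧
      ‖fderiv ℝ g y‖ ≤ C₂ ∧ a / 2 < fderiv ℝ g y (0, e) := by
    refine Filter.Eventually.and (h.isOpen.mem_nhds hzW) (Filter.Eventually.and
      (hF.isOpen.mem_nhds hzN) (hC₁.and (hC₂.and ?_)))
    have hct : ContinuousOn (fun y => fderiv ℝ g y (0, e)) W :=
      h.continuousOn_fderiv.clm_apply continuousOn_const
    exact (hct.continuousAt (h.isOpen.mem_nhds hzW)).eventually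
      (lt_mem_nhds (show a / 2 < a by linarith))
  have hall := (hYc.eventually hev).and (hcurve.and (hr.eventually (by simp)))
  obtain ⟨δ, hδ, hball⟩ := Metric.eventually_nhds_iff_ball.1 hall
  have hC₁0 : 0 ≤ C₁ := (norm_nonneg _).trans (hC₁.self_of_nhds hzH)
  refine ⟨δ, hδ, ?_⟩
  set S : Set ℝ := Ici 0 ∩ Metric.ball z.1 δ with hS
  have hSo : S.OrdConnected := by
    rw [hS, Real.ball_eq_Ioo]
    exact ordConnected_Ici.inter ordConnected_Ioo
  have hzS : z.1 ∈ S := ⟨hzH, Metric.mem_ball_self hδ⟩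
  have hYH : ∀ s ∈ S, Y s ∈ closedHalf d := fun s hs => hs.1
  have hYF : ∀ s ∈ S, Y s ∈ front Ω := fun s hs =>
    (h.mem_front_iff hF.dom (hball s hs.2).1.1 (hYH s hs)).2 (hball s hs.2).2.1
  have hrd : ∀ s ∈ S, HasDerivAt r (deriv r s) s := fun s hs =>
    ((hball s hs.2).2.2.differentiableAt one_ne_zero).hasDerivAt
  have hYd : ∀ s ∈ S, HasDerivAt Y (1, u z + deriv r s • e) s := by
    intro s hs
    have h1 : HasDerivAt (fun s => z.2 + (s - z.1) • u z + r s • e) (u z + deriv r s • e) s := by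
      have := ((((hasDerivAt_id s).sub_const z.1).smul_const (u z)).const_add z.2).add
        ((hrd s hs).smul_const e)
      rw [one_smul] at this
      exact this
    exact (hasDerivAt_id s).prodMk h1
  set q : ℝ → Space d := fun s => u (Y s) - u z with hq
  have hsplit : ∀ s, ((1 : ℝ), u z + deriv r s • e)
      = ((1, u (Y s)) : SpaceTime d) + (0, deriv r s • e - q s) := by
    intro s
    rw [Prod.mk_add_mk, Prod.mk.injEq]
    exact ⟨by simp, by simp only [hq]; abel⟩
  -- The derivative of `u` along the curve splits into the part along `(1, u)`, which is zero on the
  -- front, and a spatial remainder that is linear in `r'` and `q`.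
  have hqd : ∀ s ∈ S, HasDerivWithinAt q (D (Y s) (0, deriv r s • e - q s)) S s := by
    intro s hs
    have hu : HasFDerivWithinAt u (D (Y s)) (N ∩ closedHalf d) (Y s) :=
      (hF.velocity.differentiableOn one_ne_zero (Y s)
        ⟨(hball s hs.2).1.2.1, hYH s hs⟩).hasFDerivWithinAt
    have h1 := hu.comp_hasDerivWithinAt s (hYd s hs).hasDerivWithinAt (s := S)
      (fun x hx => ⟨(hball x hx.2).1.2.1, hYH x hx⟩)
    rw [hsplit, map_add, hF.acceleration_front (hYF s hs), zero_add] at h1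
    exact h1.sub_const (u z)
  -- Both the velocity of the curve and `(1, u)` are tangent to the front, so `dg` kills their
  -- difference. This gives `r' ∂_e g = ∇g · q`, with `∂_e g` bounded below, and closes the Gronwall
  -- inequality for `q`.
  have hrq : ∀ s ∈ S, |deriv r s| ≤ 2 * C₂ / a * ‖q s‖ := by
    intro s hs
    obtain ⟨⟨hW', -, -, hC, ha'⟩, -, -⟩ := hball s hs.2
    have h1 : HasDerivAt (fun s => g (Y s)) (fderiv ℝ g (Y s) (1, u z + deriv r s • e)) s :=
      (h.differentiableAt hW').hasFDerivAt.comp_hasDerivAt s (hYd s hs)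
    have h2 : HasDerivAt (fun s => g (Y s)) 0 s := by
      refine (hasDerivAt_const s (0 : ℝ)).congr_of_eventuallyEq ?_
      filter_upwards [Metric.isOpen_ball.mem_nhds hs.2] with x hx using (hball x hx).2.1
    have h3 := h1.unique h2
    rw [hsplit, map_add, hF.tangent h hW' (hYF s hs), zero_add] at h3
    have h4 : ((0 : ℝ), deriv r s • e - q s) = deriv r s • ((0, e) : SpaceTime d) - (0, q s) := by
      simp
    rw [h4, map_sub, map_smul, smul_eq_mul, sub_eq_zero] at h3
    have h5 : |deriv r s| * (a / 2) ≤ C₂ * ‖q s‖ := by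
      calc |deriv r s| * (a / 2) ≤ |deriv r s| * fderiv ℝ g (Y s) (0, e) := by gcongr
        _ = |deriv r s * fderiv ℝ g (Y s) (0, e)| := by
            rw [abs_mul, abs_of_pos (lt_trans (by positivity) ha')]
        _ = ‖fderiv ℝ g (Y s) (0, q s)‖ := by rw [h3]; rfl
        _ ≤ ‖fderiv ℝ g (Y s)‖ * ‖((0 : ℝ), q s)‖ := ContinuousLinearMap.le_opNorm _ _
        _ = ‖fderiv ℝ g (Y s)‖ * ‖q s‖ := by simp [Prod.norm_def]
        _ ≤ C₂ * ‖q s‖ := by gcongr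
    rw [div_mul_eq_mul_div, le_div_iff₀ hapos]
    linarith
  have hqK : ∀ s ∈ S, ‖D (Y s) (0, deriv r s • e - q s)‖
      ≤ C₁ * (2 * C₂ / a * ‖e‖ + 1) * ‖q s‖ := by
    intro s hs
    calc ‖D (Y s) (0, deriv r s • e - q s)‖ ≤ ‖D (Y s)‖ * ‖((0 : ℝ), deriv r s • e - q s)‖ :=
          ContinuousLinearMap.le_opNorm _ _
      _ = ‖D (Y s)‖ * ‖deriv r s • e - q s‖ := by simp [Prod.norm_def]
      _ ≤ C₁ * (|deriv r s| * ‖e‖ + ‖q s‖) := by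
          have := (hball s hs.2).1.2.2.1 (hYH s hs)
          gcongr
          refine (norm_sub_le _ _).trans ?_
          rw [norm_smul, Real.norm_eq_abs]
      _ ≤ C₁ * (2 * C₂ / a * ‖q s‖ * ‖e‖ + ‖q s‖) := by
          have := hrq s hs
          gcongr
      _ = _ := by ring
  have hq0 : ∀ s ∈ S, q s = 0 := fun s hs =>
    eq_zero_of_norm_deriv_le hSo hqd hqK hzS hs (by simp [hq, hY, hrz])
  have hr0 : ∀ s ∈ S, r s = 0 := fun s hs =>
    eq_zero_of_norm_deriv_le (K := 0) hSo (fun s hs => (hrd s hs).hasDerivWithinAt)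
      (fun s hs => by
        have := hrq s hs
        rw [hq0 s hs] at this
        simpa using this) hzS hs hrz
  intro s hs0 hsδ
  have hs : s ∈ S := ⟨hs0, by rwa [Metric.mem_ball, Real.dist_eq]⟩
  have hYs : Y s = (s, z.2 + (s - z.1) • u z) := by simp [hY, hr0 s hs]
  rw [← hYs]
  exact ⟨hYF s hs, sub_eq_zero.1 (hq0 s hs)⟩

theorem continuousOn_velocity_front (hF : IsRegularFlow A γ Ω N ρ u) :
    ContinuousOn u (front Ω) :=
  hF.velocity.continuousOn.mono fun _ hy => ⟨hF.front_subset hy, hF.dom.front_subset_closedHalf hy⟩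

/-- Each point of the front moves forever (and from time `0` on) along a straight line, with
constant velocity. -/
theorem line_mem_front (hF : IsRegularFlow A γ Ω N ρ u) (hz : z ∈ front Ω) {s : ℝ} (hs : 0 ≤ s) :
    (s, z.2 + (s - z.1) • u z) ∈ front Ω ∧ u (s, z.2 + (s - z.1) • u z) = u z := by
  set l : ℝ → SpaceTime d := fun s => (s, z.2 + (s - z.1) • u z) with hl
  have hlc : Continuous l := by fun_prop
  -- Continuation in time: `T` is closed because the front is closed and `u` is continuous on it,
  -- open by the local statement, and contains `z.1`.
  set T : Set (Ici (0 : ℝ)) := {s | l s ∈ front Ω ∧ u (l s) = u z} with hT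
  have hclosed : IsClosed T := by
    have h1 : IsClosed (front Ω ∩ u ⁻¹' {u z}) :=
      hF.continuousOn_velocity_front.preimage_isClosed_of_isClosed hF.dom.isClosed_front
        isClosed_singleton
    exact h1.preimage (hlc.comp continuous_subtype_val)
  have hopen : IsOpen T := by
    rw [Metric.isOpen_iff]
    rintro s ⟨hs1, hs2⟩
    obtain ⟨δ, hδ, hloc⟩ := hF.line_mem_front_local hs1
    refine ⟨δ, hδ, fun x hx => ?_⟩
    have h1 := hloc x x.2 (by rw [← Real.dist_eq]; exact hx)
    rw [hs2] at h1
    have h2 : ((x : ℝ), (l s).2 + ((x : ℝ) - (l s).1) • u z) = l x := by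
      simp only [hl, Prod.mk.injEq, true_and]
      module
    rw [h2] at h1
    exact h1
  have hconn : PreconnectedSpace (Ici (0 : ℝ)) := Subtype.preconnectedSpace isPreconnected_Ici
  have hzT : (⟨z.1, hF.dom.front_subset_closedHalf hz⟩ : Ici (0 : ℝ)) ∈ T := by
    simp [hT, hl, hz]
  have huniv : T = univ :=
    (isClopen_iff.1 ⟨hclosed, hopen⟩).resolve_left (nonempty_iff_ne_empty.1 ⟨_, hzT⟩)
  exact (huniv ▸ mem_univ _ : (⟨s, hs⟩ : Ici (0 : ℝ)) ∈ T)

end IsRegularFlow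

end

/-! ### Time slices: boundaries, topology and bounds. -/

section

variable {d : ℕ} {A γ : ℝ} {ρ : SpaceTime d → ℝ} {u : SpaceTime d → Space d}
  {Ω W N : Set (SpaceTime d)} {g : SpaceTime d → ℝ} {e : Space d} {z : SpaceTime d} {t : ℝ}
  {x : Space d}

theorem continuous_prodMk_left (t : ℝ) : Continuous fun x : Space d => ((t, x) : SpaceTime d) := by
  fun_prop

namespace IsMovingDomain

theorem isOpen_slice (hΩ : IsMovingDomain Ω) (ht : 0 ≤ t) : IsOpen (slice Ω t) := by
  obtain ⟨U, hU, rfl⟩ := hΩ.rel_open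
  have : slice (U ∩ closedHalf d) t = (fun x => ((t, x) : SpaceTime d)) ⁻¹' U := by
    ext x
    exact ⟨fun h => h.1, fun h => ⟨h, ht⟩⟩
  rw [this]
  exact hU.preimage (continuous_prodMk_left t)

/-- Taking boundaries commutes with slicing because `∇_x g ≠ 0`: a front point is a limit of points
of `Ω` at the same time. -/
theorem mem_front_iff_mem_frontier (hΩ : IsMovingDomain Ω) (ht : 0 ≤ t) :
    (t, x) ∈ front Ω ↔ x ∈ frontier (slice Ω t) := by
  rw [frontier, (hΩ.isOpen_slice ht).interior_eq]
  constructor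
  · intro hz
    refine ⟨?_, hz.2⟩
    obtain ⟨W, g, e, hzW, h⟩ := hΩ.exists_chart hz
    have h0 := (h.mem_front_iff hΩ hzW ht).1 hz
    have hray : Filter.Tendsto (fun s : ℝ => x + s • e) (𝓝[<] 0) (𝓝 x) := by
      have : Continuous fun s : ℝ => x + s • e := by fun_prop
      have h1 := this.tendsto 0
      simp only [zero_smul, add_zero] at h1
      exact h1.mono_left nhdsWithin_le_nhds
    refine mem_closure_of_tendsto hray ?_
    filter_upwards [(h.eventually_sign hzW (h.pos _ hzW)).filter_mono nhdsWithin_le_nhds,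
      self_mem_nhdsWithin, ((IsChart.tendsto_ray (t, x) (0, e)).eventually
      (h.isOpen.mem_nhds hzW)).filter_mono nhdsWithin_le_nhds] with s hs (hs0 : s < 0) hsW
    have heq : ((t, x) : SpaceTime d) + s • ((0, e) : SpaceTime d) = (t, x + s • e) := by simp
    rw [heq] at hs hsW
    rw [sign_neg hs0, sign_eq_neg_one_iff, h0, sub_zero] at hs
    exact (h.mem_iff _ ⟨hsW, ht⟩).2 hs
  · rintro ⟨h1, h2⟩
    exact ⟨map_mem_closure (continuous_prodMk_left t) h1 fun y hy => hy, h2⟩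

theorem isCompact_frontier (hΩ : IsMovingDomain Ω) (ht : 0 ≤ t) :
    IsCompact (frontier (slice Ω t)) :=
  Metric.isCompact_of_isClosed_isBounded isClosed_frontier
    ((hΩ.bounded t ht).closure.subset frontier_subset_closure)

/-- A path in the closed half-space that avoids the front does not leave `Ω`. -/
theorem mem_of_path (hΩ : IsMovingDomain Ω) {I : Set ℝ} (hI : IsPreconnected I)
    {f : ℝ → SpaceTime d} (hf : ContinuousOn f I) (hH : ∀ s ∈ I, f s ∈ closedHalf d)
    (hfr : ∀ s ∈ I, f s ∉ front Ω) {a b : ℝ} (ha : a ∈ I) (hb : b ∈ I) (haΩ : f a ∈ Ω) :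
    f b ∈ Ω := by
  obtain ⟨U, hU, hΩU⟩ := hΩ.rel_open
  have hconn : PreconnectedSpace I := Subtype.preconnectedSpace hI
  have hfc : Continuous fun s : I => f s := continuousOn_iff_continuous_domRestrict.1 hf
  set T : Set I := {s | f s ∈ Ω} with hT
  have h1 : IsClosed T := by
    have : T = (fun s : I => f s) ⁻¹' closure Ω := by
      ext s
      refine ⟨fun h => subset_closure h, fun h => ?_⟩
      by_contra h'
      exact hfr s s.2 ⟨h, h'⟩
    rw [this]
    exact isClosed_closure.preimage hfc
  have h2 : IsOpen T := by
    have : T = (fun s : I => f s) ⁻¹' U := by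
      ext s
      simp only [hT, mem_ofPred_eq, mem_preimage]
      rw [hΩU]
      exact ⟨fun h => h.1, fun h => ⟨h, hH s s.2⟩⟩
    rw [this]
    exact hU.preimage hfc
  have huniv : T = univ := (isClopen_iff.1 ⟨h1, h2⟩).resolve_left
    (nonempty_iff_ne_empty.1 ⟨⟨a, ha⟩, haΩ⟩)
  exact (huniv ▸ mem_univ _ : (⟨b, hb⟩ : I) ∈ T)

/-- Otherwise `Ω` would be open and closed in the connected half-space, hence all of it, and its
slices would be unbounded. -/
theorem front_nonempty (hd : 1 ≤ d) (hΩ : IsMovingDomain Ω) : (front Ω).Nonempty := by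
  by_contra hne
  rw [not_nonempty_iff_eq_empty] at hne
  have hcl : closure Ω ⊆ Ω := sdiff_eq_empty.1 hne
  obtain ⟨U, hU, hΩU⟩ := hΩ.rel_open
  have hconn : PreconnectedSpace (closedHalf d) :=
    Subtype.preconnectedSpace convex_closedHalf.isPreconnected
  set T : Set (closedHalf d) := Subtype.val ⁻¹' Ω with hT
  have h1 : IsClosed T := (closure_subset_iff_isClosed.1 hcl).preimage continuous_subtype_val
  have h2 : IsOpen T := by
    have : T = Subtype.val ⁻¹' U := by
      ext y
      simp only [hT, mem_preimage]
      rw [hΩU]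
      exact ⟨fun h => h.1, fun h => ⟨h, y.2⟩⟩
    rw [this]
    exact hU.preimage continuous_subtype_val
  obtain ⟨y, hy⟩ := hΩ.nonempty
  have huniv : T = univ := (isClopen_iff.1 ⟨h1, h2⟩).resolve_left
    (nonempty_iff_ne_empty.1 ⟨⟨y, hΩ.subset_closedHalf hy⟩, hy⟩)
  have hs : slice Ω 0 = univ := by
    ext x
    have h0 : ((0, x) : SpaceTime d) ∈ closedHalf d := le_refl (0 : ℝ)
    have : (⟨(0, x), h0⟩ : closedHalf d) ∈ T := huniv ▸ mem_univ _
    exact ⟨fun _ => mem_univ _, fun _ => this⟩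
  have hb := hΩ.bounded 0 le_rfl
  rw [hs] at hb
  have : Nonempty (Fin d) := ⟨⟨0, hd⟩⟩
  exact NormedSpace.unbounded_univ ℝ (Space d) hb

end IsMovingDomain

namespace IsRegularFlow

theorem frontier_motion (hF : IsRegularFlow A γ Ω N ρ u) (ht : 0 ≤ t) {s : ℝ} (hs : 0 ≤ s)
    (hx : x ∈ frontier (slice Ω t)) :
    x + (s - t) • u (t, x) ∈ frontier (slice Ω s) ∧
      u (s, x + (s - t) • u (t, x)) = u (t, x) := by
  have h := hF.line_mem_front ((hF.dom.mem_front_iff_mem_frontier ht).2 hx) hs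
  exact ⟨(hF.dom.mem_front_iff_mem_frontier hs).1 h.1, h.2⟩

/-- One front point exists at some time, and its straight line visits every other time. -/
theorem frontier_nonempty (hF : IsRegularFlow A γ Ω N ρ u) (hd : 1 ≤ d) (ht : 0 ≤ t) :
    (frontier (slice Ω t)).Nonempty := by
  obtain ⟨z, hz⟩ := hF.dom.front_nonempty hd
  exact ⟨_, (hF.dom.mem_front_iff_mem_frontier ht).1 (hF.line_mem_front hz ht).1⟩

/-- The gas remains in a bounded region for bounded times. -/
theorem bounded_of_le (hF : IsRegularFlow A γ Ω N ρ u) (T : ℝ) :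
    ∃ R, 0 < R ∧ ∀ z ∈ Ω, z.1 ≤ T → ‖z.2‖ < R := by
  have hK := hF.dom.isCompact_frontier (t := 0) le_rfl
  have hu0 : ContinuousOn (fun x => u (0, x)) (frontier (slice Ω 0)) :=
    hF.continuousOn_velocity_front.comp (continuous_prodMk_left 0).continuousOn
      fun x hx => (hF.dom.mem_front_iff_mem_frontier le_rfl).2 hx
  obtain ⟨C₁, hC₁⟩ := hK.isBounded.exists_norm_le
  obtain ⟨C₂, hC₂⟩ := (hK.image_of_continuousOn hu0).isBounded.exists_norm_le
  refine ⟨|C₁| + |T| * |C₂| + 1, by positivity, fun z hz hzT => ?_⟩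
  have hz0 : 0 ≤ z.1 := hF.dom.subset_closedHalf hz
  -- Each boundary point is traced back to its position at time `0`, where positions and velocities
  -- range over compact sets.
  have hfr : ∀ y ∈ frontier (slice Ω z.1), ‖y‖ ≤ |C₁| + |T| * |C₂| := by
    intro y hy
    obtain ⟨h1, h2⟩ := hF.frontier_motion hz0 le_rfl hy
    set x := y + (0 - z.1) • u (z.1, y) with hx
    have hyx : y = x + z.1 • u (0, x) := by rw [h2, hx]; module
    have b1 : ‖x‖ ≤ |C₁| := (hC₁ x h1).trans (le_abs_self _)
    have b2 : ‖u (0, x)‖ ≤ |C₂| := (hC₂ _ ⟨x, h1, rfl⟩).trans (le_abs_self _)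
    calc ‖y‖ = ‖x + z.1 • u (0, x)‖ := by rw [← hyx]
      _ ≤ ‖x‖ + z.1 * ‖u (0, x)‖ := by
          refine (norm_add_le _ _).trans ?_
          rw [norm_smul, Real.norm_of_nonneg hz0]
      _ ≤ |C₁| + |T| * |C₂| := by
          have : z.1 ≤ |T| := hzT.trans (le_abs_self T)
          gcongr
  by_contra! hcon
  have hz2 : 0 < ‖z.2‖ := lt_of_lt_of_le (by positivity) hcon
  -- The outward ray from a point beyond all boundary points never meets the front, so it would stay
  -- in `Ω`, against the boundedness of the slice.
  have hsub : ∀ s ∈ Ici (1 : ℝ), ((z.1, s • z.2) : SpaceTime d) ∈ Ω := by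
    intro s hs
    refine hF.dom.mem_of_path (f := fun s => (z.1, s • z.2)) isPreconnected_Ici (by fun_prop)
      (fun _ _ => hz0) ?_ (mem_Ici.2 le_rfl) hs (by simpa using hz)
    intro s (hs : 1 ≤ s) hsf
    have h3 := hfr _ ((hF.dom.mem_front_iff_mem_frontier hz0).1 hsf)
    rw [norm_smul, Real.norm_of_nonneg (by linarith)] at h3
    nlinarith
  obtain ⟨C, hC⟩ := (hF.dom.bounded z.1 hz0).exists_norm_le
  have hm := hC _ (hsub ((|C| + 1) / ‖z.2‖ + 1) (by
    simp only [mem_Ici, le_add_iff_nonneg_left]; positivity))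
  rw [norm_smul, Real.norm_of_nonneg (by positivity), add_mul, div_mul_cancel₀ _ hz2.ne'] at hm
  linarith [le_abs_self C]

end IsRegularFlow

end

/-! ### The determinant of `1 + τ L` as a polynomial, and smooth cutoffs. -/

section

section Determinant

open Polynomial

theorem continuous_coeff_prod {Z ι : Type*} [TopologicalSpace Z] {f : Z → ι → ℝ[X]}
    (s : Finset ι) (hf : ∀ i k, Continuous fun z => (f z i).coeff k) (k : ℕ) :
    Continuous fun z => (∏ i ∈ s, f z i).coeff k := by
  classical
  induction s using Finset.induction_on generalizing k with
  | empty => simpa using continuous_const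
  | insert i s hi ih =>
    simp only [Finset.prod_insert hi, coeff_mul]
    exact continuous_finsetSum _ fun p _ => (hf i p.1).mul (ih p.2)

/-- The coefficients of the determinant of a matrix of polynomials depend continuously on those of
the entries. -/
theorem continuous_coeff_det {Z n : Type*} [TopologicalSpace Z] [Fintype n] [DecidableEq n]
    {f : Z → Matrix n n ℝ[X]} (hf : ∀ i j k, Continuous fun z => (f z i j).coeff k) (k : ℕ) :
    Continuous fun z => (f z).det.coeff k := by
  simp only [Matrix.det_apply, finsetSum_coeff, Units.smul_def, coeff_smul]
  refine continuous_finsetSum _ fun σ _ => ?_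
  exact (continuous_coeff_prod Finset.univ (fun i k => hf (σ i) i k) k).const_smul
    ((Equiv.Perm.sign σ : ℤˣ) : ℤ)

variable {d : ℕ}

/-- `det (1 + τ L)` is a polynomial in `τ` of degree at most `d`, with coefficients depending
continuously on `L`, and leading coefficient `det L`. -/
theorem exists_det_one_add_smul_eq (d : ℕ) :
    ∃ c : ℕ → (Space d →L[ℝ] Space d) → ℝ, (∀ j, Continuous (c j)) ∧ (∀ L, c d L = L.det) ∧
      ∀ (τ : ℝ) L, (1 + τ • L).det = ∑ j ∈ Finset.range (d + 1), c j L * τ ^ j := by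
  classical
  set b := (EuclideanSpace.basisFun (Fin d) ℝ).toBasis with hb
  set M : (Space d →L[ℝ] Space d) → Matrix (Fin d) (Fin d) ℝ :=
    fun L => LinearMap.toMatrix b b (L : Space d →ₗ[ℝ] Space d) with hM
  have hMdet : ∀ L, (M L).det = L.det := fun L => LinearMap.det_toMatrix b _
  set P : (Space d →L[ℝ] Space d) → ℝ[X] := fun L =>
    ((X : ℝ[X]) • (M L).map C + (1 : Matrix (Fin d) (Fin d) ℝ).map C).det with hP
  have hMc : ∀ i j, Continuous fun L => M L i j := by
    intro i j
    have : (fun L => M L i j) = fun L => L (b j) i := by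
      ext L
      simp [hM, LinearMap.toMatrix_apply, hb]
    rw [this]
    exact (EuclideanSpace.proj (𝕜 := ℝ) i).continuous.comp
      (ContinuousLinearMap.apply ℝ (Space d) (b j)).continuous
  refine ⟨fun j L => (P L).coeff j, fun j => ?_, fun L => ?_, fun τ L => ?_⟩
  · refine continuous_coeff_det (fun i j k => ?_) j
    simp only [Matrix.add_apply, Matrix.smul_apply, Matrix.map_apply, coeff_add, smul_eq_mul]
    refine Continuous.add ?_ continuous_const
    rcases k with _ | k
    · simpa using continuous_const
    · simp only [coeff_X_mul, coeff_C]
      split_ifs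
      · exact hMc i j
      · exact continuous_const
  · have h := coeff_det_X_add_C_card (M L) 1
    rw [Fintype.card_fin] at h
    exact h.trans (hMdet L)
  · have hdeg : (P L).natDegree < d + 1 := by
      have := natDegree_det_X_add_C_le (M L) 1
      rw [Fintype.card_fin] at this
      exact Nat.lt_succ_of_le this
    rw [← eval_eq_sum_range' hdeg, hP]
    have h1 : M (1 + τ • L) = 1 + τ • M L := by
      simp only [hM, ContinuousLinearMap.toLinearMap_add, ContinuousLinearMap.toLinearMap_smul,
        map_add, map_smul]
      congr 1
      exact LinearMap.toMatrix_id b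
    rw [← hMdet, h1, ← coe_evalRingHom, RingHom.map_det]
    congr 1
    ext i j
    simp [Matrix.one_apply, add_comm]
    split_ifs <;> simp [mul_comm]

/-- Integrated version of `exists_det_one_add_smul_eq`. -/
theorem exists_integral_det_eq {D : Set (Space d)} (hD : Bornology.IsBounded D)
    {L : Space d → Space d →L[ℝ] Space d}
    (hL : ContinuousOn L (closure D)) :
    ∃ a : ℕ → ℝ, a d = ∫ x in D, (L x).det ∧
      ∀ τ : ℝ, ∫ x in D, (1 + τ • L x).det = ∑ j ∈ Finset.range (d + 1), a j * τ ^ j := by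
  obtain ⟨c, hc, hcd, hdet⟩ := exists_det_one_add_smul_eq d
  have hint : ∀ j, IntegrableOn (fun x => c j (L x)) D := fun j =>
    (((hc j).comp_continuousOn hL).integrableOn_compact hD.isCompact_closure).mono_set
      subset_closure
  refine ⟨fun j => ∫ x in D, c j (L x), by simp only [hcd], fun τ => ?_⟩
  simp only [hdet]
  rw [integral_finsetSum _ fun j _ => (hint j).mul_const _]
  exact Finset.sum_congr rfl fun j _ => integral_mul_const _ _

end Determinant

/-- A smooth cutoff function which is `1` on a given compact set. -/
theorem exists_contDiff_one_of_isCompact {E : Type*} [NormedAddCommGroup E] [NormedSpace ℝ E]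
    [FiniteDimensional ℝ E] {K V : Set E} (hK : IsCompact K) (hV : IsOpen V) (hKV : K ⊆ V) :
    ∃ χ : E → ℝ, ContDiff ℝ ∞ χ ∧ HasCompactSupport χ ∧ tsupport χ ⊆ V ∧ ∀ x ∈ K, χ x = 1 := by
  obtain ⟨K', hK', h1, h2⟩ := exists_compact_between hK hV hKV
  obtain ⟨χ, hχ, -, hs, hone⟩ := exists_contMDiff_support_eq_eq_one_iff (n := ⊤)
    (modelWithCornersSelf ℝ E) isOpen_interior hK.isClosed h1
  have hsub : tsupport χ ⊆ K' :=
    closure_minimal (hs.subset.trans interior_subset) hK'.isClosed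
  exact ⟨χ, hχ.contDiff, hK'.of_isClosed_subset (isClosed_tsupport χ) hsub, hsub.trans h2,
    fun x hx => (hone x).1 hx⟩

theorem contDiff_smul_of_tsupport_subset {E F : Type*} [NormedAddCommGroup E] [NormedSpace ℝ E]
    [NormedAddCommGroup F] [NormedSpace ℝ F] {χ : E → ℝ} {v : E → F} {V : Set E} (hV : IsOpen V)
    (hχ : ContDiff ℝ 1 χ) (hχV : tsupport χ ⊆ V) (hv : ContDiffOn ℝ 1 v V) :
    ContDiff ℝ 1 fun x => χ x • v x := by
  rw [contDiff_iff_contDiffAt]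
  intro x
  by_cases hx : x ∈ tsupport χ
  · exact hχ.contDiffAt.smul (hv.contDiffAt (hV.mem_nhds (hχV hx)))
  · refine (contDiffAt_const (c := (0 : F))).congr_of_eventuallyEq ?_
    filter_upwards [(isClosed_tsupport χ).isOpen_compl.mem_nhds hx] with y hy
    rw [image_eq_zero_of_notMem_tsupport hy, zero_smul]

end

/-! ### The volume of the gas region is a polynomial in time. -/

section

variable {d : ℕ} {A γ : ℝ} {ρ : SpaceTime d → ℝ} {u : SpaceTime d → Space d}
  {Ω N : Set (SpaceTime d)} {t : ℝ} {x : Space d} {w v : Space d → Space d}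

section Perturbation

open scoped NNReal

variable {K : ℝ≥0} {τ : ℝ}

theorem norm_smul_sub_smul_le (hw : LipschitzWith K w) (hτ : |τ| * K ≤ 1 / 2) (x y : Space d) :
    ‖τ • w x - τ • w y‖ ≤ 1 / 2 * ‖x - y‖ := by
  rw [← smul_sub, norm_smul, Real.norm_eq_abs]
  calc |τ| * ‖w x - w y‖ ≤ |τ| * (K * ‖x - y‖) := by
        gcongr
        exact hw.norm_sub_le x y
    _ = |τ| * K * ‖x - y‖ := by ring
    _ ≤ _ := by gcongr

theorem injective_add_smul (hw : LipschitzWith K w) (hτ : |τ| * K ≤ 1 / 2) :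
    Function.Injective fun x => x + τ • w x := by
  intro x y hxy
  have h1 := norm_smul_sub_smul_le hw hτ y x
  have h2 : x - y = τ • w y - τ • w x := by
    have hxy' : x + τ • w x = y + τ • w y := hxy
    rw [sub_eq_sub_iff_add_eq_add, hxy', add_comm]
  rw [← h2, norm_sub_rev y x] at h1
  have : ‖x - y‖ = 0 := le_antisymm (by linarith) (norm_nonneg _)
  exact sub_eq_zero.1 (norm_eq_zero.1 this)

/-- A preimage of `y` is a fixed point of the contraction `x ↦ y - τ • w x`. -/
theorem surjective_add_smul (hw : LipschitzWith K w) (hτ : |τ| * K ≤ 1 / 2) :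
    Function.Surjective fun x => x + τ • w x := by
  intro y
  have hc : ContractingWith (1 / 2) fun x => y - τ • w x := by
    refine ⟨by norm_num, LipschitzWith.of_dist_le_mul fun a b => ?_⟩
    rw [dist_eq_norm, dist_eq_norm, sub_sub_sub_cancel_left, norm_sub_rev a b]
    exact norm_smul_sub_smul_le hw hτ b a
  refine ⟨hc.fixedPoint, ?_⟩
  have h := hc.fixedPoint_isFixedPt
  rw [Function.IsFixedPt] at h
  change ContractingWith.fixedPoint _ hc + τ • w (ContractingWith.fixedPoint _ hc) = y
  rw [← eq_sub_iff_add_eq]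
  exact h.symm

end Perturbation

namespace IsRegularFlow

/-- The domain is transported by any small perturbation of the identity with the right boundary
values. -/
theorem image_slice_eq (hF : IsRegularFlow A γ Ω N ρ u) (ht : 0 ≤ t)
    {K : NNReal} (hw : LipschitzWith K w) (hwu : ∀ x ∈ frontier (slice Ω t), w x = u (t, x))
    {δ : ℝ} (hδ : δ * K ≤ 1 / 2) {s : ℝ} (hs : 0 ≤ s) (hst : |s - t| < δ) :
    (fun x => x + (s - t) • w x) '' slice Ω t = slice Ω s := by
  set I : Set ℝ := Ici 0 ∩ Metric.ball t δ with hI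
  have hIp : IsPreconnected I := by
    rw [hI, Real.ball_eq_Ioo]
    exact (ordConnected_Ici.inter ordConnected_Ioo).isPreconnected
  have hsI : s ∈ I := ⟨hs, by rwa [Metric.mem_ball, Real.dist_eq]⟩
  have htI : t ∈ I := ⟨ht, Metric.mem_ball_self (lt_of_le_of_lt (abs_nonneg _) hst)⟩
  have hIδ : ∀ r ∈ I, |r - t| * K ≤ 1 / 2 := fun r hr =>
    (mul_le_mul_of_nonneg_right (by
      have := hr.2
      rw [Metric.mem_ball, Real.dist_eq] at this
      exact this.le) K.coe_nonneg).trans hδ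
  -- A trajectory on the boundary at time `r` is traced back along the front to a boundary point
  -- `x'` at time `t`. Both `x` and `x'` arrive at the same place, and injectivity identifies them.
  have hback : ∀ r ∈ I, ∀ x, x + (r - t) • w x ∈ frontier (slice Ω r) →
      x ∈ frontier (slice Ω t) := by
    intro r hr x hx
    obtain ⟨h1, h2⟩ := hF.frontier_motion hr.1 ht hx
    set y := x + (r - t) • w x
    set x' := y + (t - r) • u (r, y) with hx'
    have h3 : x' + (r - t) • w x' = x + (r - t) • w x := by
      rw [hwu x' h1, h2, hx']
      change _ = y
      module
    exact injective_add_smul hw (hIδ r hr) h3 ▸ h1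
  -- Trajectories starting off the boundary never meet the front, so they cannot change sides.
  have hpath : ∀ x ∉ frontier (slice Ω t), ∀ a ∈ I, ∀ b ∈ I,
      x + (a - t) • w x ∈ slice Ω a → x + (b - t) • w x ∈ slice Ω b := by
    intro x hx a ha b hb
    refine hF.dom.mem_of_path (f := fun r => (r, x + (r - t) • w x)) hIp (by fun_prop)
      (fun r hr => hr.1) (fun r hr hfr => hx (hback r hr x ?_)) ha hb
    exact (hF.dom.mem_front_iff_mem_frontier hr.1).1 hfr
  ext y
  constructor
  · rintro ⟨x, hx, rfl⟩
    have hxf : x ∉ frontier (slice Ω t) := by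
      rw [frontier, (hF.dom.isOpen_slice ht).interior_eq]
      exact fun h => h.2 hx
    exact hpath x hxf t htI s hsI (by simpa using hx)
  · intro hy
    obtain ⟨x, rfl⟩ := surjective_add_smul hw (hIδ s hsI) y
    refine ⟨x, ?_, rfl⟩
    have hxf : x ∉ frontier (slice Ω t) := by
      intro h
      have h1 := (hF.frontier_motion ht hs h).1
      rw [← hwu x h, frontier, (hF.dom.isOpen_slice hs).interior_eq] at h1
      exact h1.2 hy
    simpa using hpath x hxf s hsI t htI hy

/-- The volume of the domain at nearby times. -/
theorem volume_slice_eventually (hF : IsRegularFlow A γ Ω N ρ u) (ht : 0 ≤ t)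
    (hw : ContDiff ℝ 1 w) (hwc : HasCompactSupport w)
    (hwu : ∀ x ∈ frontier (slice Ω t), w x = u (t, x)) :
    ∃ δ > 0, ∀ s, 0 ≤ s → |s - t| < δ →
      volume.real (slice Ω s) = ∫ x in slice Ω t, (1 + (s - t) • fderiv ℝ w x).det := by
  obtain ⟨K, hK⟩ := hw.lipschitzWith_of_hasCompactSupport hwc one_ne_zero
  -- The Jacobian stays positive near the identity. This removes the absolute value from the change
  -- of variables and leaves a polynomial in `s - t`.
  obtain ⟨η, hη, hdet⟩ : ∃ η > 0, ∀ L : Space d →L[ℝ] Space d, ‖L‖ < η → 0 < (1 + L).det := by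
    have hc : Continuous fun L : Space d →L[ℝ] Space d => (1 + L).det :=
      ContinuousLinearMap.continuous_det.comp (continuous_const.add continuous_id)
    have h1 : (0 : ℝ) < (1 + (0 : Space d →L[ℝ] Space d)).det := by
      rw [add_zero, ContinuousLinearMap.det]
      have : ((1 : Space d →L[ℝ] Space d) : Space d →ₗ[ℝ] Space d) = LinearMap.id := rfl
      rw [this, LinearMap.det_id]
      exact one_pos
    obtain ⟨η, hη, h⟩ := Metric.eventually_nhds_iff.1 (hc.continuousAt.eventually (lt_mem_nhds h1))
    exact ⟨η, hη, fun L hL => h (by rwa [dist_zero_right])⟩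
  refine ⟨min (1 / (2 * (K + 1))) (η / (K + 1)), by positivity, fun s hs hst => ?_⟩
  set δ := min (1 / (2 * ((K : ℝ) + 1))) (η / (K + 1)) with hδ
  have hδK : δ * K ≤ 1 / 2 := by
    calc δ * K ≤ 1 / (2 * ((K : ℝ) + 1)) * (K + 1) := by
          gcongr
          · exact min_le_left _ _
          · linarith
      _ = 1 / 2 := by field_simp
  have hst' : |s - t| * K ≤ 1 / 2 := (mul_le_mul_of_nonneg_right hst.le K.coe_nonneg).trans hδK
  have hpos : ∀ x, 0 < (1 + (s - t) • fderiv ℝ w x).det := by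
    intro x
    apply hdet
    rw [norm_smul, Real.norm_eq_abs]
    calc |s - t| * ‖fderiv ℝ w x‖ ≤ |s - t| * (K + 1) := by
          gcongr
          exact (norm_fderiv_le_of_lipschitz ℝ hK).trans (by linarith)
      _ < η / (K + 1) * (K + 1) := by
          gcongr
          exact hst.trans_le (min_le_right _ _)
      _ = η := by field_simp
  rw [← hF.image_slice_eq ht hK hwu hδK hs hst]
  have h := integral_image_eq_integral_abs_det_fderiv_smul volume
    (hF.dom.isOpen_slice ht).measurableSet (f := fun x => x + (s - t) • w x)
    (f' := fun x => 1 + (s - t) • fderiv ℝ w x)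
    (fun x _ => ((hasFDerivAt_id x).add
      (((hw.differentiable one_ne_zero x).hasFDerivAt).const_smul (s - t))).hasFDerivWithinAt)
    (injective_add_smul hK hst').injOn (fun _ => (1 : ℝ))
  rw [setIntegral_const] at h
  simp only [smul_eq_mul, mul_one, abs_of_pos (hpos _)] at h
  exact h

/-- The boundary velocity extends to a compactly supported `C¹` vector field. -/
theorem exists_extension (hF : IsRegularFlow A γ Ω N ρ u) (ht : 0 ≤ t) :
    ∃ w : Space d → Space d, ContDiff ℝ 1 w ∧ HasCompactSupport w ∧
      ∀ x ∈ frontier (slice Ω t), w x = u (t, x) := by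
  set V : Set (Space d) := (fun x => ((t, x) : SpaceTime d)) ⁻¹' N with hV
  have hVo : IsOpen V := hF.isOpen.preimage (continuous_prodMk_left t)
  have hsub : frontier (slice Ω t) ⊆ V := fun x hx =>
    hF.front_subset ((hF.dom.mem_front_iff_mem_frontier ht).2 hx)
  obtain ⟨χ, hχ, hχc, hχV, hone⟩ :=
    exists_contDiff_one_of_isCompact (hF.dom.isCompact_frontier ht) hVo hsub
  have huV : ContDiffOn ℝ 1 (fun x => u (t, x)) V :=
    hF.velocity.comp (contDiff_const.prodMk contDiff_id).contDiffOn fun x hx => ⟨hx, ht⟩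
  refine ⟨fun x => χ x • u (t, x),
    contDiff_smul_of_tsupport_subset hVo (hχ.of_le (by simp)) hχV huV, ?_, fun x hx => ?_⟩
  · exact hχc.smul_right
  · simp only [hone x hx, one_smul]

/-- Here the extension depends on the base time `t`. Only the existence of some local polynomial
matters, as it is what continuation in time requires. -/
theorem volume_slice_eventually_polynomial (hF : IsRegularFlow A γ Ω N ρ u) (ht : 0 ≤ t) :
    ∃ p : Polynomial ℝ, ∃ δ > 0, ∀ s, 0 ≤ s → |s - t| < δ →
      volume.real (slice Ω s) = p.eval s := by
  obtain ⟨w, hw, hwc, hwu⟩ := hF.exists_extension ht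
  obtain ⟨δ, hδ, hvol⟩ := hF.volume_slice_eventually ht hw hwc hwu
  obtain ⟨a, -, ha⟩ := exists_integral_det_eq (hF.dom.bounded t ht)
    (hw.continuous_fderiv one_ne_zero).continuousOn
  refine ⟨∑ j ∈ Finset.range (d + 1), Polynomial.C (a j) *
    (Polynomial.X - Polynomial.C t) ^ j, δ, hδ, fun s hs hst => ?_⟩
  rw [hvol s hs hst, ha, Polynomial.eval_finsetSum]
  simp

/-- Cutting `v` off away from the closure of `Ω(0)` gives compact support without changing `∇v` on
`Ω(0)`, so the prescribed `v` itself computes the volume at small times. -/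
theorem volume_slice_eventually_extension (hF : IsRegularFlow A γ Ω N ρ u)
    (hv : IsC1Extension (slice Ω 0) (fun x => u (0, x)) v) :
    ∃ δ > 0, ∀ s, 0 ≤ s → |s| < δ →
      volume.real (slice Ω s) = ∫ x in slice Ω 0, (1 + s • fderiv ℝ v x).det := by
  obtain ⟨⟨V, hV, hDV, hvV⟩, hvu⟩ := hv
  have hD0 := hF.dom.isOpen_slice (t := 0) le_rfl
  obtain ⟨χ, hχ, hχc, hχV, hone⟩ := exists_contDiff_one_of_isCompact
    (hF.dom.bounded 0 le_rfl).isCompact_closure hV hDV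
  obtain ⟨δ, hδ, hvol⟩ := hF.volume_slice_eventually le_rfl (w := fun x => χ x • v x)
    (contDiff_smul_of_tsupport_subset hV (hχ.of_le (by simp)) hχV hvV) hχc.smul_right
    (fun x hx => by simp only [hone x (frontier_subset_closure hx), one_smul]; exact hvu x hx)
  refine ⟨δ, hδ, fun s hs hst => ?_⟩
  rw [hvol s hs (by simpa using hst)]
  refine setIntegral_congr_fun hD0.measurableSet fun x hx => ?_
  have : (fun x => χ x • v x) =ᶠ[𝓝 x] v := by
    filter_upwards [hD0.mem_nhds hx] with y hy
    rw [hone y (subset_closure hy), one_smul]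
  simp only [this.fderiv_eq, sub_zero]

/-- The volume of the domain is a polynomial in time. -/
theorem exists_volume_slice_eq (hF : IsRegularFlow A γ Ω N ρ u)
    (hv : IsC1Extension (slice Ω 0) (fun x => u (0, x)) v) :
    ∃ a : ℕ → ℝ, a d = ∫ x in slice Ω 0, (fderiv ℝ v x).det ∧
      ∀ t, 0 ≤ t → volume.real (slice Ω t) = ∑ j ∈ Finset.range (d + 1), a j * t ^ j := by
  obtain ⟨V, hV, hDV, hvV⟩ := hv.1
  obtain ⟨a, had, ha⟩ := exists_integral_det_eq (hF.dom.bounded 0 le_rfl)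
    ((hvV.continuousOn_fderiv_of_isOpen hV le_rfl).mono hDV)
  refine ⟨a, had, ?_⟩
  set P : Polynomial ℝ := ∑ j ∈ Finset.range (d + 1), Polynomial.C (a j) * Polynomial.X ^ j with hP
  have hPe : ∀ t, P.eval t = ∑ j ∈ Finset.range (d + 1), a j * t ^ j := fun t => by
    rw [hP, Polynomial.eval_finsetSum]
    simp
  set f : ℝ → ℝ := fun t => volume.real (slice Ω t) - P.eval t with hf
  obtain ⟨δ₀, hδ₀, h₀⟩ := hF.volume_slice_eventually_extension hv
  -- The map `x + t v(x)` may lose injectivity for large `t`, so the formula is continued instead.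
  -- Near a limit point of `T` the volume is some polynomial `p`, which agrees with `P` on a
  -- nontrivial interval and hence equals it.
  set T : Set (Ici (0 : ℝ)) := {t | ∀ᶠ s : Ici (0 : ℝ) in 𝓝 t, f s = 0} with hT
  have hconn : PreconnectedSpace (Ici (0 : ℝ)) := Subtype.preconnectedSpace isPreconnected_Ici
  have hopen : IsOpen T := isOpen_setOfPred_eventually_nhds
  have h0T : (⟨0, mem_Ici.2 le_rfl⟩ : Ici (0 : ℝ)) ∈ T := by
    refine Metric.eventually_nhds_iff.2 ⟨δ₀, hδ₀, fun s hs => ?_⟩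
    have hs' : |(s : ℝ)| < δ₀ := by
      have h1 : dist (s : ℝ) 0 < δ₀ := hs
      rwa [Real.dist_eq, sub_zero] at h1
    rw [hf]
    simp only [hPe, ← ha]
    rw [h₀ s s.2 hs', sub_self]
  have hclosed : IsClosed T := by
    refine isClosed_of_closure_subset fun t ht => ?_
    obtain ⟨p, δ, hδ, hp⟩ := hF.volume_slice_eventually_polynomial t.2
    obtain ⟨t', ht'T, ht'⟩ := Metric.mem_closure_iff.1 ht δ hδ
    obtain ⟨ε, hε, hεT⟩ := Metric.eventually_nhds_iff.1 ht'T
    have ht'' : |(t' : ℝ) - t| < δ := by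
      rw [dist_comm] at ht'
      exact ht'
    have hpP : p = P := by
      refine Polynomial.eq_of_infinite_eval_eq p P ((Ioo_infinite (show (t' : ℝ) <
        min (t' + ε) (t + δ) from lt_min (by linarith) (by linarith [(abs_lt.1 ht'').2]))).mono ?_)
      intro s hs
      have hs0 : 0 ≤ s := t'.2.trans hs.1.le
      have h1 : s < t' + ε := hs.2.trans_le (min_le_left _ _)
      have h2 : s < t + δ := hs.2.trans_le (min_le_right _ _)
      have h3 : f s = 0 := hεT (y := ⟨s, hs0⟩) (by
        have : dist s (t' : ℝ) < ε := by
          rw [Real.dist_eq, abs_lt]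
          exact ⟨by linarith [hs.1], by linarith⟩
        exact this)
      have h4 := hp s hs0 (abs_lt.2 ⟨by linarith [hs.1, (abs_lt.1 ht'').1], by linarith⟩)
      rw [mem_ofPred_eq, ← h4]
      exact sub_eq_zero.1 h3
    refine Metric.eventually_nhds_iff.2 ⟨δ, hδ, fun s hs => ?_⟩
    rw [hf]
    simp only
    rw [hp s s.2 hs, hpP, sub_self]
  have huniv : T = univ :=
    (isClopen_iff.1 ⟨hclosed, hopen⟩).resolve_left (nonempty_iff_ne_empty.1 ⟨_, h0T⟩)
  intro t ht
  have h1 : (⟨t, ht⟩ : Ici (0 : ℝ)) ∈ T := huniv ▸ mem_univ _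
  rw [← hPe]
  exact sub_eq_zero.1 (Filter.Eventually.self_of_nhds (p := fun s : Ici (0 : ℝ) => f s = 0) h1)

end IsRegularFlow

end

/-! ### Balance laws tested against `η(t) ψ(x)`, and integrability on time slabs. -/

section

variable {d : ℕ} {A γ : ℝ} {ρ : SpaceTime d → ℝ} {u : SpaceTime d → Space d}
  {Ω N : Set (SpaceTime d)} {a b : ℝ} {η : ℝ → ℝ} {ψ : Space d → ℝ}

theorem fderiv_mul_prod {f : Space d → ℝ} {z : SpaceTime d} {f' : Space d →L[ℝ] ℝ}
    (hη : DifferentiableAt ℝ η z.1) (hf : HasFDerivAt f f' z.2) (v : SpaceTime d) :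
    fderiv ℝ (fun z : SpaceTime d => η z.1 * f z.2) z v
      = v.1 * (deriv η z.1 * f z.2) + η z.1 * f' v.2 := by
  have h1 : HasFDerivAt (fun z : SpaceTime d => η z.1)
      ((fderiv ℝ η z.1).comp (ContinuousLinearMap.fst ℝ ℝ (Space d))) z :=
    hη.hasFDerivAt.comp z hasFDerivAt_fst
  have h2 : HasFDerivAt (fun z : SpaceTime d => f z.2)
      (f'.comp (ContinuousLinearMap.snd ℝ ℝ (Space d))) z := hf.comp z hasFDerivAt_snd
  rw [(h1.fun_mul h2).fderiv]
  have h3 : fderiv ℝ η z.1 v.1 = v.1 * deriv η z.1 := by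
    rw [fderiv_eq_smul_deriv, smul_eq_mul]
  simp only [add_apply, smul_apply, ContinuousLinearMap.comp_apply, ContinuousLinearMap.coe_fst',
    ContinuousLinearMap.coe_snd', smul_eq_mul, h3]
  ring

theorem eq_zero_of_notMem_Icc (hs : tsupport η ⊆ Icc a b) {t : ℝ} (ht : t ∉ Icc a b) : η t = 0 :=
  image_eq_zero_of_notMem_tsupport fun h => ht (hs h)

theorem tsupport_deriv_subset_Icc (hs : tsupport η ⊆ Icc a b) : tsupport (deriv η) ⊆ Icc a b :=
  tsupport_deriv_subset.trans hs

namespace IsRegularFlow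

/-- Test functions of the form `η(t) ψ(x)`, where `ψ` need not have compact support: they can be
truncated outside of the gas. -/
theorem exists_test (hF : IsRegularFlow A γ Ω N ρ u) (ha : 0 < a) (hη : ContDiff ℝ ∞ η)
    (hs : tsupport η ⊆ Icc a b) (hψ : ContDiff ℝ ∞ ψ) :
    ∃ φ : SpaceTime d → ℝ, IsTest φ ∧ (∀ z ∈ Ω, ∀ v : SpaceTime d,
      fderiv ℝ φ z v = v.1 * (deriv η z.1 * ψ z.2) + η z.1 * fderiv ℝ ψ z.2 v.2) ∧
      ((∀ t, 0 ≤ η t) → (∀ x, 0 ≤ ψ x) → ∀ z, 0 ≤ φ z) := by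
  obtain ⟨R, hR, hΩR⟩ := hF.bounded_of_le b
  obtain ⟨χ, hχ, hχc, -, hone⟩ := exists_contDiff_one_of_isCompact
    (isCompact_closedBall (0 : Space d) R) isOpen_univ (subset_univ _)
  have hηc : HasCompactSupport η := isCompact_Icc.of_isClosed_subset (isClosed_tsupport η) hs
  -- The square keeps the truncation nonnegative, as the energy inequality requires, with no sign
  -- condition on `χ`.
  set f : Space d → ℝ := fun x => χ x ^ 2 * ψ x with hf
  have hfC : ContDiff ℝ ∞ f := (hχ.pow 2).mul hψ
  set φ : SpaceTime d → ℝ := fun z => η z.1 * f z.2 with hφ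
  have hsupp : tsupport φ ⊆ tsupport η ×ˢ tsupport χ := by
    refine closure_minimal (fun z hz => ?_) ((isClosed_tsupport η).prod (isClosed_tsupport χ))
    refine ⟨subset_tsupport η fun h => hz ?_, subset_tsupport χ fun h => hz ?_⟩
    · simp [hφ, h]
    · simp [hφ, hf, h]
  refine ⟨φ, ⟨(hη.comp contDiff_fst).mul (hfC.comp contDiff_snd), ?_, ?_⟩, fun z hz v => ?_,
    fun h1 h2 z => mul_nonneg (h1 _) (mul_nonneg (sq_nonneg _) (h2 _))⟩
  · exact (hηc.isCompact.prod hχc.isCompact).of_isClosed_subset (isClosed_tsupport φ) hsupp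
  · exact fun z hz => lt_of_lt_of_le ha (hs (hsupp hz).1).1
  · rw [fderiv_mul_prod (hη.differentiable (by simp) z.1)
      (hfC.differentiable (by simp) z.2).hasFDerivAt]
    -- Up to time `b` the gas lies in the open ball of radius `R`, where `χ = 1`; after time `b`
    -- both `η` and its derivative vanish.
    by_cases hzb : z.1 ≤ b
    · have hev : f =ᶠ[𝓝 z.2] ψ := by
        have hball : Metric.closedBall (0 : Space d) R ∈ 𝓝 z.2 :=
          Filter.mem_of_superset (Metric.isOpen_ball.mem_nhds
            (show z.2 ∈ Metric.ball (0 : Space d) R by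
              rw [mem_ball_zero_iff]; exact hΩR z hz hzb)) Metric.ball_subset_closedBall
        filter_upwards [hball] with y hy
        simp [hf, hone y hy]
      rw [hev.fderiv_eq, hev.eq_of_nhds]
    · have hz' : z.1 ∉ Icc a b := fun h => hzb h.2
      rw [eq_zero_of_notMem_Icc hs hz',
        eq_zero_of_notMem_Icc (tsupport_deriv_subset_Icc hs) hz']
      simp

theorem ae_vacuum (hF : IsRegularFlow A γ Ω N ρ u) :
    ∀ᵐ z ∂(volume.restrict (openHalf d)), z ∈ Ω ∨ ρ z = 0 := by
  filter_upwards [hF.gas.vacuum_outside] with z hz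
  by_cases h : z ∈ Ω
  · exact Or.inl h
  · exact Or.inr (hz h)

theorem pressure_zero (hF : IsRegularFlow A γ Ω N ρ u) : pressure A γ 0 = 0 := by
  rw [pressure, Real.zero_rpow (by linarith [hF.hγ]), mul_zero]

/-- Conservation of mass, tested against `η(t) ψ(x)`. -/
theorem mass_test (hF : IsRegularFlow A γ Ω N ρ u) (ha : 0 < a) (hη : ContDiff ℝ ∞ η)
    (hs : tsupport η ⊆ Icc a b) (hψ : ContDiff ℝ ∞ ψ) :
    ∫ z in openHalf d, ρ z * (deriv η z.1 * ψ z.2 + η z.1 * fderiv ℝ ψ z.2 (u z)) = 0 := by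
  obtain ⟨φ, hφ, hD, -⟩ := hF.exists_test ha hη hs hψ
  rw [← hF.sol.mass φ hφ]
  refine integral_congr_ae ?_
  filter_upwards [hF.ae_vacuum] with z hz
  rcases hz with hz | hz
  · simp only [dt, dx, hD z hz, map_zero]
    ring
  · simp [hz]

/-- Balance of momentum, tested against `η(t) ψ(x)`. -/
theorem momentum_test (hF : IsRegularFlow A γ Ω N ρ u) (ha : 0 < a) (hη : ContDiff ℝ ∞ η)
    (hs : tsupport η ⊆ Icc a b) (hψ : ContDiff ℝ ∞ ψ) (i : Fin d) :
    ∫ z in openHalf d, (ρ z * u z i * (deriv η z.1 * ψ z.2 + η z.1 * fderiv ℝ ψ z.2 (u z))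
      + pressure A γ (ρ z) * (η z.1 * fderiv ℝ ψ z.2 (EuclideanSpace.single i 1))) = 0 := by
  obtain ⟨φ, hφ, hD, -⟩ := hF.exists_test ha hη hs hψ
  rw [← hF.sol.momentum φ hφ i]
  refine integral_congr_ae ?_
  filter_upwards [hF.ae_vacuum] with z hz
  rcases hz with hz | hz
  · simp only [dt, dx, hD z hz, map_zero]
    ring
  · simp [hz, hF.pressure_zero]

/-- Dissipation of the total energy. -/
theorem energy_test (hF : IsRegularFlow A γ Ω N ρ u) (ha : 0 < a) (hη : ContDiff ℝ ∞ η)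
    (hs : tsupport η ⊆ Icc a b) (hη0 : ∀ t, 0 ≤ η t) :
    0 ≤ ∫ z in openHalf d, energyDensity A γ (ρ z) (u z) * deriv η z.1 := by
  obtain ⟨φ, hφ, hD, hnn⟩ := hF.exists_test (ψ := fun _ => 1) ha hη hs contDiff_const
  refine (hF.sol.energy φ hφ (hnn hη0 fun _ => zero_le_one)).trans_eq (integral_congr_ae ?_)
  filter_upwards [hF.ae_vacuum] with z hz
  rcases hz with hz | hz
  · simp only [dt, dx, hD z hz, map_zero]
    simp
  · simp [hz, hF.pressure_zero, energyDensity]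

/-- A quantity that vanishes with the density and is locally integrable at positive times is
integrable on time slabs. -/
theorem integrableOn_mul_of_slab (hF : IsRegularFlow A γ Ω N ρ u) {G k : SpaceTime d → ℝ}
    (hG : ∀ K : Set (SpaceTime d), IsCompact K → K ⊆ openHalf d → IntegrableOn G K)
    (hG0 : ∀ z, ρ z = 0 → G z = 0) (hk : Continuous k) (ha : 0 < a)
    (hk0 : ∀ z : SpaceTime d, z.1 ∉ Icc a b → k z = 0) :
    IntegrableOn (fun z => G z * k z) (openHalf d) := by
  obtain ⟨R, hR, hΩR⟩ := hF.bounded_of_le b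
  set K : Set (SpaceTime d) := Icc a b ×ˢ Metric.closedBall 0 R with hK
  have hKc : IsCompact K := isCompact_Icc.prod (isCompact_closedBall _ _)
  have hKo : K ⊆ openHalf d := fun z hz => lt_of_lt_of_le ha hz.1.1
  have h1 : IntegrableOn (fun z => G z * k z) K := (hG K hKc hKo).mul_continuousOn
    hk.continuousOn hKc
  refine ((integrable_indicator_iff hKc.measurableSet).2
    (h1.mono_measure Measure.restrict_le_self : IntegrableOn (fun z => G z * k z) K
      (volume.restrict (openHalf d)))).congr ?_
  filter_upwards [hF.ae_vacuum] with z hz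
  by_cases hzK : z ∈ K
  · rw [indicator_of_mem hzK]
  · rw [indicator_of_notMem hzK]
    rcases hz with hz | hz
    · by_cases hzt : z.1 ∈ Icc a b
      · exact absurd ⟨hzt, mem_closedBall_zero_iff.2 (hΩR z hz hzt.2).le⟩ hzK
      · rw [hk0 z hzt, mul_zero]
    · rw [hG0 z hz, zero_mul]

end IsRegularFlow

namespace IsAdmissibleSolution

variable {K : Set (SpaceTime d)}

theorem integrableOn_density (hsol : IsAdmissibleSolution A γ ρ u) (hK : IsCompact K)
    (hKo : K ⊆ openHalf d) : IntegrableOn ρ K := by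
  obtain ⟨C, hC⟩ := hsol.locally_bounded K hK hKo
  refine IntegrableOn.of_bound hK.measure_lt_top
    (hsol.meas_density.mono_measure (Measure.restrict_mono_set _ hKo)) C ?_
  filter_upwards [hC, ae_restrict_mem hK.measurableSet] with z hz hzK
  rw [Real.norm_of_nonneg (hsol.density_nonneg z (openHalf_subset_closedHalf (hKo hzK)))]
  exact hz.1

theorem aestronglyMeasurable_coord (hsol : IsAdmissibleSolution A γ ρ u) (hKo : K ⊆ openHalf d)
    (i : Fin d) : AEStronglyMeasurable (fun z => u z i) (volume.restrict K) :=
  (EuclideanSpace.proj (𝕜 := ℝ) i).continuous.comp_aestronglyMeasurable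
    (hsol.meas_velocity.mono_measure (Measure.restrict_mono_set _ hKo))

theorem integrableOn_momentum (hsol : IsAdmissibleSolution A γ ρ u) (hK : IsCompact K)
    (hKo : K ⊆ openHalf d) (i : Fin d) : IntegrableOn (fun z => ρ z * u z i) K := by
  obtain ⟨C, hC⟩ := hsol.locally_bounded K hK hKo
  refine IntegrableOn.of_bound hK.measure_lt_top
    ((hsol.meas_density.mono_measure (Measure.restrict_mono_set _ hKo)).mul
      (hsol.aestronglyMeasurable_coord hKo i)) C ?_
  filter_upwards [hC] with z hz
  exact (PiLp.norm_apply_le (ρ z • u z) i).trans hz.2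

theorem integrableOn_sq (hsol : IsAdmissibleSolution A γ ρ u) (hK : IsCompact K)
    (hKo : K ⊆ openHalf d) : IntegrableOn (fun z => ρ z * ‖u z‖ ^ 2) K :=
  hsol.integrable_sq.integrableOn_compact_subset hKo hK

theorem integrableOn_coord_sq (hsol : IsAdmissibleSolution A γ ρ u) (hK : IsCompact K)
    (hKo : K ⊆ openHalf d) (i : Fin d) : IntegrableOn (fun z => ρ z * (u z i) ^ 2) K := by
  refine (hsol.integrableOn_sq hK hKo).mono'
    ((hsol.meas_density.mono_measure (Measure.restrict_mono_set _ hKo)).mul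
      ((hsol.aestronglyMeasurable_coord hKo i).pow 2)) ?_
  filter_upwards [ae_restrict_mem hK.measurableSet] with z hzK
  have h0 := hsol.density_nonneg z (openHalf_subset_closedHalf (hKo hzK))
  rw [Real.norm_of_nonneg (by positivity)]
  refine mul_le_mul_of_nonneg_left ?_ h0
  exact (sq_abs _).symm.le.trans
    (pow_le_pow_left₀ (abs_nonneg _) (PiLp.norm_apply_le (u z) i) 2)

theorem integrableOn_pressure (hsol : IsAdmissibleSolution A γ ρ u) (hA : 0 < A) (hγ : 1 < γ)
    (hK : IsCompact K) (hKo : K ⊆ openHalf d) :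
    IntegrableOn (fun z => pressure A γ (ρ z)) K := by
  obtain ⟨C, hC⟩ := hsol.locally_bounded K hK hKo
  refine IntegrableOn.of_bound hK.measure_lt_top (C := A * C ^ γ) ?_ ?_
  · exact (((hsol.meas_density.mono_measure (Measure.restrict_mono_set _ hKo)).aemeasurable.pow_const
      γ).const_mul A).aestronglyMeasurable
  filter_upwards [hC, ae_restrict_mem hK.measurableSet] with z hz hzK
  have h0 := hsol.density_nonneg z (openHalf_subset_closedHalf (hKo hzK))
  rw [pressure, Real.norm_of_nonneg (by positivity)]
  gcongr
  exact hz.1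

end IsAdmissibleSolution

end

/-! ### The dispersion inequality. -/

section

variable {d : ℕ} {A γ : ℝ} {ρ : SpaceTime d → ℝ} {u : SpaceTime d → Space d}
  {Ω N : Set (SpaceTime d)} {a b k : ℝ} {θ w : ℝ → ℝ}

/-- The dispersion density `½ ρ |x - t u|² + t² ρ e`. -/
noncomputable def dispersion (A γ : ℝ) (ρ : SpaceTime d → ℝ) (u : SpaceTime d → Space d)
    (z : SpaceTime d) : ℝ :=
  1 / 2 * ρ z * ‖z.2 - z.1 • u z‖ ^ 2 + z.1 ^ 2 * (pressure A γ (ρ z) / (γ - 1))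

theorem inner_eq_sum (x y : Space d) : inner ℝ x y = ∑ i, x i * y i := by
  rw [PiLp.inner_apply]
  exact Finset.sum_congr rfl fun i _ => by simp [mul_comm]

/-- The expansion shows which law controls which term: mass for `|x|²`, momentum for `x · u`, energy
for the coefficient of `t²`. -/
theorem dispersion_eq (z : SpaceTime d) :
    dispersion A γ ρ u z = 1 / 2 * ρ z * ‖z.2‖ ^ 2 - z.1 * (ρ z * ∑ i, z.2 i * u z i)
      + 1 / 2 * z.1 ^ 2 * (ρ z * ‖u z‖ ^ 2) + z.1 ^ 2 * (pressure A γ (ρ z) / (γ - 1)) := by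
  rw [dispersion, norm_sub_sq_real, inner_smul_right, inner_eq_sum, norm_smul, mul_pow,
    Real.norm_eq_abs, sq_abs]
  ring

/-- The real power is singular only at `t = 0`, away from the support of `θ`. -/
theorem contDiff_rpow_mul (r : ℝ) (ha : 0 < a) (hθ : ContDiff ℝ ∞ θ) (hs : tsupport θ ⊆ Icc a b) :
    ContDiff ℝ ∞ fun t => t ^ r * θ t := by
  rw [contDiff_iff_contDiffAt]
  intro t
  by_cases ht : t ∈ tsupport θ
  · exact (contDiffAt_id.rpow_const_of_ne (lt_of_lt_of_le ha (hs ht).1).ne').mul hθ.contDiffAt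
  · refine (contDiffAt_const (c := (0 : ℝ))).congr_of_eventuallyEq ?_
    filter_upwards [(isClosed_tsupport θ).isOpen_compl.mem_nhds ht] with y hy
    rw [image_eq_zero_of_notMem_tsupport hy, mul_zero]

theorem tsupport_mul_subset_Icc (f : ℝ → ℝ) (hs : tsupport θ ⊆ Icc a b) :
    tsupport (fun t => f t * θ t) ⊆ Icc a b :=
  (tsupport_mul_subset_right (f := f) (g := θ)).trans hs

theorem deriv_rpow_mul {t : ℝ} (ht : 0 < t) (hθ : DifferentiableAt ℝ θ t) :
    deriv (fun t => t ^ (-k) * θ t) t = t ^ (-k) * deriv θ t - k * (t ^ (-k - 1) * θ t) := by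
  have h := ((Real.hasDerivAt_rpow_const (p := -k) (Or.inl ht.ne')).fun_mul hθ.hasDerivAt).deriv
  rw [h]
  ring

namespace IsRegularFlow

theorem integrableOn_density_mul (hF : IsRegularFlow A γ Ω N ρ u) (ha : 0 < a) (hw : Continuous w)
    (hw0 : ∀ t, t ∉ Icc a b → w t = 0) {f : SpaceTime d → ℝ} (hf : Continuous f) :
    IntegrableOn (fun z => ρ z * (w z.1 * f z)) (openHalf d) :=
  hF.integrableOn_mul_of_slab (fun _ => hF.sol.integrableOn_density) (fun _ h => h) (by fun_prop)
    ha fun z hz => by rw [hw0 _ hz, zero_mul]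

theorem integrableOn_momentum_mul (hF : IsRegularFlow A γ Ω N ρ u) (ha : 0 < a)
    (hw : Continuous w) (hw0 : ∀ t, t ∉ Icc a b → w t = 0) {f : SpaceTime d → ℝ}
    (hf : Continuous f) (i : Fin d) :
    IntegrableOn (fun z => ρ z * u z i * (w z.1 * f z)) (openHalf d) :=
  hF.integrableOn_mul_of_slab (fun _ h h' => hF.sol.integrableOn_momentum h h' i)
    (fun _ h => by rw [h, zero_mul]) (by fun_prop) ha fun z hz => by rw [hw0 _ hz, zero_mul]

theorem integrableOn_sq_mul (hF : IsRegularFlow A γ Ω N ρ u) (ha : 0 < a)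
    (hw : Continuous w) (hw0 : ∀ t, t ∉ Icc a b → w t = 0) {f : SpaceTime d → ℝ}
    (hf : Continuous f) :
    IntegrableOn (fun z => ρ z * ‖u z‖ ^ 2 * (w z.1 * f z)) (openHalf d) :=
  hF.integrableOn_mul_of_slab (fun _ h h' => hF.sol.integrableOn_sq h h')
    (fun _ h => by rw [h, zero_mul]) (by fun_prop) ha fun z hz => by rw [hw0 _ hz, zero_mul]

theorem integrableOn_coord_sq_mul (hF : IsRegularFlow A γ Ω N ρ u) (ha : 0 < a)
    (hw : Continuous w) (hw0 : ∀ t, t ∉ Icc a b → w t = 0) (i : Fin d) :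
    IntegrableOn (fun z => ρ z * u z i ^ 2 * w z.1) (openHalf d) :=
  hF.integrableOn_mul_of_slab (fun _ h h' => hF.sol.integrableOn_coord_sq h h' i)
    (fun _ h => by rw [h, zero_mul]) (by fun_prop) ha fun z hz => hw0 _ hz

theorem integrableOn_pressure_mul (hF : IsRegularFlow A γ Ω N ρ u) (ha : 0 < a)
    (hw : Continuous w) (hw0 : ∀ t, t ∉ Icc a b → w t = 0) {f : SpaceTime d → ℝ}
    (hf : Continuous f) :
    IntegrableOn (fun z => pressure A γ (ρ z) * (w z.1 * f z)) (openHalf d) :=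
  hF.integrableOn_mul_of_slab (fun _ h h' => hF.sol.integrableOn_pressure hF.hA hF.hγ h h')
    (fun _ h => by rw [h, hF.pressure_zero]) (by fun_prop) ha
    fun z hz => by rw [hw0 _ hz, zero_mul]

theorem integrableOn_dispersion_mul (hF : IsRegularFlow A γ Ω N ρ u) (ha : 0 < a)
    (hw : Continuous w) (hw0 : ∀ t, t ∉ Icc a b → w t = 0) :
    IntegrableOn (fun z => dispersion A γ ρ u z * w z.1) (openHalf d) := by
  have h1 := hF.integrableOn_density_mul ha hw hw0 (f := fun z => 1 / 2 * ‖z.2‖ ^ 2) (by fun_prop)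
  have h2 : ∀ i, IntegrableOn (fun z => ρ z * u z i * (w z.1 * (z.1 * z.2 i))) (openHalf d) :=
    fun i => hF.integrableOn_momentum_mul ha hw hw0 (by fun_prop) i
  have h3 := hF.integrableOn_sq_mul ha hw hw0 (f := fun z => 1 / 2 * z.1 ^ 2) (by fun_prop)
  have h4 := hF.integrableOn_pressure_mul ha hw hw0 (f := fun z => z.1 ^ 2 / (γ - 1)) (by fun_prop)
  refine (((h1.sub (integrable_finsetSum Finset.univ fun i _ => h2 i)).add h3).add h4).congr
    (ae_of_all _ fun z => ?_)
  have e : ∑ i, ρ z * u z i * (w z.1 * (z.1 * z.2 i))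
      = w z.1 * z.1 * (ρ z * ∑ i, z.2 i * u z i) := by
    rw [Finset.mul_sum, Finset.mul_sum]
    exact Finset.sum_congr rfl fun i _ => by ring
  simp only [Pi.add_apply, Pi.sub_apply, e, dispersion_eq]
  ring

/-- Time decay of the weighted dispersion, in the weak sense. -/
theorem dispersion_test (hF : IsRegularFlow A γ Ω N ρ u) (ha : 0 < a) (hθ : ContDiff ℝ ∞ θ)
    (hs : tsupport θ ⊆ Icc a b) (hθ0 : ∀ t, 0 ≤ θ t) (hk : 0 ≤ k)
    (hkd : 2 - d * (γ - 1) ≤ k) :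
    0 ≤ ∫ z in openHalf d, dispersion A γ ρ u z * (z.1 ^ (-k) * deriv θ z.1) := by
  -- The weight `t ^ (-k)` absorbs the source term left when `2 - d (γ - 1) > 0`. The time factors
  -- `η`, `t η` and `t² η` will go with mass, momentum and energy, following the powers of `t` in
  -- the expanded dispersion.
  set η : ℝ → ℝ := fun t => t ^ (-k) * θ t with hη
  have hηC : ContDiff ℝ ∞ η := contDiff_rpow_mul _ ha hθ hs
  have hηs : tsupport η ⊆ Icc a b := tsupport_mul_subset_Icc _ hs
  have hη0 : ∀ t, 0 ≤ η t := by
    intro t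
    by_cases ht : t ∈ Icc a b
    · exact mul_nonneg (Real.rpow_nonneg (ha.le.trans ht.1) _) (hθ0 t)
    · rw [eq_zero_of_notMem_Icc hηs ht]
  have hηd : ∀ t, HasDerivAt η (deriv η t) t := fun t =>
    (hηC.differentiable (by simp) t).hasDerivAt
  set ζ : ℝ → ℝ := fun t => t * η t with hζ
  have hζC : ContDiff ℝ ∞ ζ := contDiff_id.mul hηC
  have hζs : tsupport ζ ⊆ Icc a b := tsupport_mul_subset_Icc _ hηs
  have hζd : ∀ t, deriv ζ t = η t + t * deriv η t := fun t => by
    rw [((hasDerivAt_id' t).fun_mul (hηd t)).deriv]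
    simp
  set ξ : ℝ → ℝ := fun t => t ^ 2 * η t with hξ
  have hξC : ContDiff ℝ ∞ ξ := (contDiff_id.pow 2).mul hηC
  have hξs : tsupport ξ ⊆ Icc a b := tsupport_mul_subset_Icc _ hηs
  have hξd : ∀ t, deriv ξ t = 2 * t * η t + t ^ 2 * deriv η t := fun t => by
    rw [((hasDerivAt_pow 2 t).fun_mul (hηd t)).deriv]
    simp
  have cont : ∀ {f : ℝ → ℝ}, ContDiff ℝ ∞ f → Continuous (deriv f) := fun hf =>
    hf.continuous_deriv (by simp)
  have van : ∀ {f : ℝ → ℝ}, tsupport f ⊆ Icc a b → ∀ t, t ∉ Icc a b → f t = 0 :=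
    fun hf t ht => eq_zero_of_notMem_Icc hf ht
  have van' : ∀ {f : ℝ → ℝ}, tsupport f ⊆ Icc a b → ∀ t, t ∉ Icc a b → deriv f t = 0 :=
    fun hf t ht => eq_zero_of_notMem_Icc (tsupport_deriv_subset_Icc hf) ht
  set FM : SpaceTime d → ℝ := fun z => ρ z * (deriv η z.1 * (1 / 2 * ‖z.2‖ ^ 2))
    + ∑ i, ρ z * u z i * (η z.1 * z.2 i) with hFM
  have iM : IntegrableOn FM (openHalf d) :=
    (hF.integrableOn_density_mul ha (cont hηC) (van' hηs) (by fun_prop)).add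
      (integrable_finsetSum _ fun i _ =>
        hF.integrableOn_momentum_mul ha hηC.continuous (van hηs) (by fun_prop) i)
  have eM : ∫ z in openHalf d, FM z = 0 := by
    rw [← hF.mass_test ha hηC hηs (ψ := fun x => 1 / 2 * ‖x‖ ^ 2)
      (contDiff_const.mul (contDiff_norm_sq ℝ))]
    refine integral_congr_ae (ae_of_all _ fun z => ?_)
    have hD : fderiv ℝ (fun x : Space d => 1 / 2 * ‖x‖ ^ 2) z.2 (u z) = ∑ i, z.2 i * u z i := by
      rw [(((hasStrictFDerivAt_norm_sq z.2).hasFDerivAt).const_mul (1 / 2)).fderiv,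
        ← inner_eq_sum]
      simp
    simp only [hFM, hD, Finset.mul_sum, mul_add]
    congr 1
    exact Finset.sum_congr rfl fun i _ => by ring
  set FP : Fin d → SpaceTime d → ℝ := fun i z => ρ z * u z i * (deriv ζ z.1 * z.2 i)
    + ρ z * u z i ^ 2 * ζ z.1 + pressure A γ (ρ z) * (ζ z.1 * 1) with hFP
  have iP : ∀ i, IntegrableOn (FP i) (openHalf d) := fun i =>
    ((hF.integrableOn_momentum_mul ha (cont hζC) (van' hζs) (by fun_prop) i).add
      (hF.integrableOn_coord_sq_mul ha hζC.continuous (van hζs) i)).add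
      (hF.integrableOn_pressure_mul ha hζC.continuous (van hζs) continuous_const)
  have eP : ∫ z in openHalf d, ∑ i, FP i z = 0 := by
    rw [integral_finsetSum _ fun i _ => iP i]
    refine Finset.sum_eq_zero fun i _ => ?_
    rw [← hF.momentum_test ha hζC hζs (EuclideanSpace.proj (𝕜 := ℝ) i).contDiff i]
    refine integral_congr_ae (ae_of_all _ fun z => ?_)
    have hproj : ∀ x : Space d, EuclideanSpace.proj (𝕜 := ℝ) i x = x i := fun _ => rfl
    simp only [hFP, ContinuousLinearMap.fderiv, hproj, PiLp.single_apply, if_true]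
    ring
  set FE : SpaceTime d → ℝ := fun z => energyDensity A γ (ρ z) (u z) * deriv ξ z.1 with hFE
  have iE : IntegrableOn FE (openHalf d) := by
    refine ((hF.integrableOn_sq_mul ha (cont hξC) (van' hξs) (f := fun _ => 1 / 2)
      continuous_const).add (hF.integrableOn_pressure_mul ha (cont hξC) (van' hξs)
      (f := fun _ => 1 / (γ - 1)) continuous_const)).congr (ae_of_all _ fun z => ?_)
    simp only [hFE, energyDensity, Pi.add_apply]
    ring
  have eE : 0 ≤ ∫ z in openHalf d, FE z := hF.energy_test ha hξC hξs
    fun t => mul_nonneg (sq_nonneg t) (hη0 t)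
  have iPs : IntegrableOn (fun z => ∑ i, FP i z) (openHalf d) :=
    integrable_finsetSum _ fun i _ => iP i
  have hθ' : ContDiff ℝ ∞ (deriv θ) := (contDiff_infty_iff_deriv.1 hθ).2
  have iJ : IntegrableOn (fun z => dispersion A γ ρ u z * (z.1 ^ (-k) * deriv θ z.1))
      (openHalf d) := by
    refine hF.integrableOn_dispersion_mul (b := b) (w := fun t => t ^ (-k) * deriv θ t) ha
      (contDiff_rpow_mul _ ha hθ' (tsupport_deriv_subset_Icc hs)).continuous fun t ht => ?_
    rw [van' hs t ht, mul_zero]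
  have e1 : 0 ≤ ∫ z in openHalf d, (FM z - ∑ i, FP i z + FE z) := by
    have h1 : ∫ z in openHalf d, (FM z - ∑ i, FP i z + FE z)
        = (∫ z in openHalf d, (FM z - ∑ i, FP i z)) + ∫ z in openHalf d, FE z :=
      integral_add (iM.sub iPs) iE
    rw [integral_sub iM iPs, eM, eP] at h1
    rw [h1]
    simpa using eE
  refine e1.trans (setIntegral_mono_on ((iM.sub iPs).add iE) iJ isOpen_openHalf.measurableSet ?_)
  intro z (hz : 0 < z.1)
  have hρ := hF.sol.density_nonneg z hz.le
  have hγ1 : 0 < γ - 1 := by linarith [hF.hγ]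
  set π := pressure A γ (ρ z) / (γ - 1) with hπ
  have hpπ : pressure A γ (ρ z) = (γ - 1) * π := by rw [hπ]; field_simp
  have hπ0 : 0 ≤ π := by
    rw [hπ, pressure]
    have := hF.hA
    positivity
  set s := z.1 ^ (-k - 1) * θ z.1 with hs'
  have hs0 : 0 ≤ s := mul_nonneg (Real.rpow_nonneg hz.le _) (hθ0 _)
  have hηs' : η z.1 = z.1 * s := by
    simp only [hη, hs']
    rw [Real.rpow_sub_one hz.ne']
    field_simp
  have hη' : deriv η z.1 = z.1 ^ (-k) * deriv θ z.1 - k * s :=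
    deriv_rpow_mul hz (hθ.differentiable (by simp) _)
  have hJ : z.1 ^ 2 * π ≤ dispersion A γ ρ u z := by
    rw [dispersion]
    have : 0 ≤ 1 / 2 * ρ z * ‖z.2 - z.1 • u z‖ ^ 2 := by positivity
    linarith
  have hsumM : ∑ i, ρ z * u z i * (η z.1 * z.2 i) = η z.1 * (ρ z * ∑ i, z.2 i * u z i) := by
    rw [Finset.mul_sum, Finset.mul_sum]
    exact Finset.sum_congr rfl fun i _ => by ring
  have hsumP : ∑ i, FP i z = deriv ζ z.1 * (ρ z * ∑ i, z.2 i * u z i)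
      + ζ z.1 * (ρ z * ‖u z‖ ^ 2) + d * (ζ z.1 * pressure A γ (ρ z)) := by
    simp only [hFP, Finset.sum_add_distrib]
    rw [EuclideanSpace.real_norm_sq_eq, Finset.mul_sum, Finset.mul_sum, Finset.mul_sum,
      Finset.mul_sum]
    congr 1
    · congr 1 <;> exact Finset.sum_congr rfl fun i _ => by ring
    · simp only [Finset.sum_const, Finset.card_univ, Fintype.card_fin, nsmul_eq_mul]
      ring
  -- In this combination the terms with `x · u` and `|u|²` that carry an undifferentiated `η`
  -- cancel. The remaining bracket is nonpositive, since `t² ρ e` is at most the dispersion and `2 -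
  -- d (γ - 1) ≤ k` with `k ≥ 0`.
  have hid : FM z - ∑ i, FP i z + FE z = dispersion A γ ρ u z * (z.1 ^ (-k) * deriv θ z.1)
      + s * (z.1 ^ 2 * π * (2 - d * (γ - 1)) - k * dispersion A γ ρ u z) := by
    rw [hsumP]
    simp only [hFM, hFE, hsumM, energyDensity, hζd, hξd]
    simp only [hζ]
    rw [dispersion_eq, ← hπ, hpπ, hη', hηs']
    ring
  rw [hid]
  have h1 : z.1 ^ 2 * π * (2 - d * (γ - 1)) ≤ k * dispersion A γ ρ u z :=
    calc z.1 ^ 2 * π * (2 - d * (γ - 1)) ≤ z.1 ^ 2 * π * k := by gcongr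
      _ = k * (z.1 ^ 2 * π) := mul_comm _ _
      _ ≤ _ := by gcongr
  have : s * (z.1 ^ 2 * π * (2 - d * (γ - 1)) - k * dispersion A γ ρ u z) ≤ 0 :=
    mul_nonpos_of_nonneg_of_nonpos hs0 (by linarith)
  linarith

end IsRegularFlow

end

/-! ### Decay of the pressure, mass interpolation and the contradiction. -/

section

variable {d : ℕ} {A γ : ℝ} {ρ : SpaceTime d → ℝ} {u : SpaceTime d → Space d}
  {Ω N : Set (SpaceTime d)} {k T : ℝ}

/-- A smooth bump function, supported in `[T, T + 1]`. -/
noncomputable def bump (T t : ℝ) : ℝ := deriv Real.smoothTransition (t - T)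

theorem contDiff_bump (T : ℝ) : ContDiff ℝ ∞ (bump T) :=
  (contDiff_infty_iff_deriv.1 (Real.smoothTransition.contDiff (n := ⊤))).2.comp
    (contDiff_id.sub contDiff_const)

theorem bump_nonneg (T t : ℝ) : 0 ≤ bump T t := Real.smoothTransition.monotone.deriv_nonneg

theorem bump_eq_zero {t : ℝ} (ht : t ∉ Icc T (T + 1)) : bump T t = 0 := by
  rw [mem_Icc, not_and_or, not_le, not_le] at ht
  unfold bump
  rcases ht with ht | ht
  · have : Real.smoothTransition =ᶠ[𝓝 (t - T)] fun _ => 0 := by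
      filter_upwards [Iio_mem_nhds (show t - T < 0 by linarith)] with s hs
      exact Real.smoothTransition.zero_of_nonpos (le_of_lt hs)
    rw [this.deriv_eq, deriv_const]
  · have : Real.smoothTransition =ᶠ[𝓝 (t - T)] fun _ => 1 := by
      filter_upwards [Ioi_mem_nhds (show 1 < t - T by linarith)] with s hs
      exact Real.smoothTransition.one_of_one_le (le_of_lt hs)
    rw [this.deriv_eq, deriv_const]

theorem tsupport_bump_subset (T : ℝ) : tsupport (bump T) ⊆ Icc T (T + 1) :=
  closure_minimal (fun _ ht => by_contra fun h => ht (bump_eq_zero h)) isClosed_Icc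

/-- All the bumps are translates of a single one, so the bound is uniform in `T`. -/
theorem exists_bump_le : ∃ C, 0 ≤ C ∧ ∀ T t, bump T t ≤ C := by
  obtain ⟨C, hC⟩ := isCompact_Icc.exists_bound_of_continuousOn
    (contDiff_bump 0).continuous.continuousOn (s := Icc (0 : ℝ) 1)
  refine ⟨|C|, abs_nonneg C, fun T t => ?_⟩
  have h : bump T t = bump 0 (t - T) := by simp [bump]
  rw [h]
  by_cases ht : t - T ∈ Icc (0 : ℝ) 1
  · exact (le_abs_self _).trans ((hC _ ht).trans (le_abs_self _))
  · rw [bump_eq_zero (by simpa using ht)]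
    exact abs_nonneg C

theorem exists_bump_pos (T : ℝ) : ∃ t > T, 0 < bump T t := by
  obtain ⟨r, hr, hslope⟩ := exists_deriv_eq_slope Real.smoothTransition (zero_lt_one' ℝ)
    Real.smoothTransition.continuous.continuousOn
    ((Real.smoothTransition.contDiff (n := 1)).differentiable (by simp)).differentiableOn
  refine ⟨T + r, by linarith [hr.1], ?_⟩
  rw [bump, add_sub_cancel_left, hslope, Real.smoothTransition.one, Real.smoothTransition.zero]
  norm_num

/-- The difference of two smooth steps converts weak time derivatives into comparisons between
averages over `[1, 2]` and `[T, T + 1]`; no trace of the solution at a fixed time is needed. -/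
theorem exists_deriv_eq_bump_sub (hT : 1 ≤ T) : ∃ θ : ℝ → ℝ, ContDiff ℝ ∞ θ ∧
    tsupport θ ⊆ Icc 1 (T + 1) ∧ (∀ t, 0 ≤ θ t) ∧ ∀ t, deriv θ t = bump 1 t - bump T t := by
  have hC : ∀ s : ℝ, ContDiff ℝ ∞ fun t => Real.smoothTransition (t - s) := fun s =>
    (Real.smoothTransition.contDiff (n := ⊤)).comp (contDiff_id.sub contDiff_const)
  refine ⟨fun t => Real.smoothTransition (t - 1) - Real.smoothTransition (t - T),
    (hC 1).sub (hC T), closure_minimal (fun t ht => by_contra fun h => ht ?_) isClosed_Icc,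
    fun t => sub_nonneg.2 (Real.smoothTransition.monotone (by linarith)), fun t => ?_⟩
  · change Real.smoothTransition (t - 1) - Real.smoothTransition (t - T) = 0
    rw [mem_Icc, not_and_or, not_le, not_le] at h
    rcases h with h | h
    · rw [Real.smoothTransition.zero_of_nonpos (by linarith),
        Real.smoothTransition.zero_of_nonpos (by linarith), sub_self]
    · rw [Real.smoothTransition.one_of_one_le (by linarith),
        Real.smoothTransition.one_of_one_le (by linarith), sub_self]
  · rw [deriv_fun_sub ((hC 1).differentiable (by simp) t) ((hC T).differentiable (by simp) t),
      deriv_comp_sub_const, deriv_comp_sub_const]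
    rfl

namespace IsRegularFlow

theorem integrableOn_density_bump (hF : IsRegularFlow A γ Ω N ρ u) (hT : 0 < T) :
    IntegrableOn (fun z => ρ z * bump T z.1) (openHalf d) := by
  simpa using hF.integrableOn_density_mul hT (contDiff_bump T).continuous
    (fun t ht => bump_eq_zero ht) (f := fun _ => 1) continuous_const

theorem integrableOn_pressure_bump (hF : IsRegularFlow A γ Ω N ρ u) (hT : 0 < T) :
    IntegrableOn (fun z => pressure A γ (ρ z) * bump T z.1) (openHalf d) := by
  simpa using hF.integrableOn_pressure_mul hT (contDiff_bump T).continuous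
    (fun t ht => bump_eq_zero ht) (f := fun _ => 1) continuous_const

/-- The mass does not depend on time. -/
theorem mass_eq (hF : IsRegularFlow A γ Ω N ρ u) (hT : 1 ≤ T) :
    ∫ z in openHalf d, ρ z * bump T z.1 = ∫ z in openHalf d, ρ z * bump 1 z.1 := by
  obtain ⟨θ, hθ, hs, -, hθ'⟩ := exists_deriv_eq_bump_sub hT
  have h := hF.mass_test (ψ := fun _ => 1) one_pos hθ hs contDiff_const
  simp only [hθ', mul_one, fderiv_fun_const, Pi.zero_apply, zero_apply, mul_zero, add_zero,
    mul_sub] at h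
  rw [integral_sub (hF.integrableOn_density_bump one_pos)
    (hF.integrableOn_density_bump (by linarith)), sub_eq_zero] at h
  exact h.symm

/-- If the mass were zero, `ρ` would vanish almost everywhere where the bump is positive. At such a
time there is a front point, which belongs to the support of `ρ`. -/
theorem mass_pos (hF : IsRegularFlow A γ Ω N ρ u) (hd : 1 ≤ d) :
    0 < ∫ z in openHalf d, ρ z * bump 1 z.1 := by
  have hnn : ∀ᵐ z ∂(volume.restrict (openHalf d)), 0 ≤ ρ z * bump 1 z.1 := by
    filter_upwards [ae_restrict_mem isOpen_openHalf.measurableSet] with z hz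
    exact mul_nonneg (hF.sol.density_nonneg z (openHalf_subset_closedHalf hz)) (bump_nonneg _ _)
  refine lt_of_le_of_ne (integral_nonneg_of_ae hnn) fun h0 => ?_
  have hae := (integral_eq_zero_iff_of_nonneg_ae hnn (hF.integrableOn_density_bump one_pos)).1
    h0.symm
  obtain ⟨t, ht, hbt⟩ := exists_bump_pos 1
  have ht0 : (0 : ℝ) ≤ t := by linarith
  obtain ⟨x, hx⟩ := hF.frontier_nonempty hd ht0
  have hz := (hF.dom.mem_front_iff_mem_frontier ht0).2 hx
  have hV : IsOpen {z : SpaceTime d | 0 < bump 1 z.1} :=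
    isOpen_lt continuous_const ((contDiff_bump 1).continuous.comp continuous_fst)
  refine hF.gas.front_subset_support _ hz _ (hV.mem_nhds hbt) ?_
  rw [← Measure.restrict_restrict hV.measurableSet, ae_restrict_iff' hV.measurableSet]
  filter_upwards [hae] with z hz (hzV : 0 < bump 1 z.1)
  exact (mul_eq_zero.1 hz).resolve_right hzV.ne'

/-- Time decay of the internal energy. -/
theorem exists_pressure_decay (hF : IsRegularFlow A γ Ω N ρ u) (hk : 0 ≤ k)
    (hkd : 2 - d * (γ - 1) ≤ k) (hk2 : k ≤ 2) :
    ∃ C, ∀ T, 1 ≤ T →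
      ∫ z in openHalf d, pressure A γ (ρ z) * bump T z.1 ≤ C * T ^ (-(2 - k)) := by
  have hγ1 : 0 < γ - 1 := by linarith [hF.hγ]
  have hint : ∀ T, 0 < T → IntegrableOn (fun z => dispersion A γ ρ u z *
      (z.1 ^ (-k) * bump T z.1)) (openHalf d) := fun T hT =>
    hF.integrableOn_dispersion_mul (b := T + 1) (w := fun t => t ^ (-k) * bump T t) hT
      (contDiff_rpow_mul _ hT (contDiff_bump T) (tsupport_bump_subset T)).continuous
      fun t ht => by rw [bump_eq_zero ht, mul_zero]
  refine ⟨(γ - 1) * ∫ z in openHalf d, dispersion A γ ρ u z * (z.1 ^ (-k) * bump 1 z.1),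
    fun T hT => ?_⟩
  have hT0 : 0 < T := by linarith
  obtain ⟨θ, hθ, hs, hθ0, hθ'⟩ := exists_deriv_eq_bump_sub hT
  have h := hF.dispersion_test one_pos hθ hs hθ0 hk hkd
  simp only [hθ', mul_sub] at h
  rw [integral_sub (hint 1 one_pos) (hint T hT0), sub_nonneg] at h
  -- The dispersion dominates `t² ρ e`, and `t ^ (2 - k) ≥ T ^ (2 - k)` on the support of the bump
  -- because `k ≤ 2`.
  have hle : ∫ z in openHalf d, T ^ (2 - k) / (γ - 1) * (pressure A γ (ρ z) * bump T z.1)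
      ≤ ∫ z in openHalf d, dispersion A γ ρ u z * (z.1 ^ (-k) * bump T z.1) := by
    refine setIntegral_mono_on ((hF.integrableOn_pressure_bump hT0).const_mul _) (hint T hT0)
      isOpen_openHalf.measurableSet fun z hz => ?_
    have hρ := hF.sol.density_nonneg z (openHalf_subset_closedHalf hz)
    have hb := bump_nonneg T z.1
    have hp : 0 ≤ pressure A γ (ρ z) := mul_nonneg hF.hA.le (Real.rpow_nonneg hρ _)
    by_cases hzT : z.1 ∈ Icc T (T + 1)
    · have hz0 : 0 < z.1 := hz
      have h1 : T ^ (2 - k) ≤ z.1 ^ 2 * z.1 ^ (-k) := by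
        rw [← Real.rpow_natCast z.1 2, ← Real.rpow_add hz0]
        exact Real.rpow_le_rpow hT0.le hzT.1 (by linarith)
      have h2 : z.1 ^ 2 * (pressure A γ (ρ z) / (γ - 1)) ≤ dispersion A γ ρ u z := by
        rw [dispersion]
        have : 0 ≤ 1 / 2 * ρ z * ‖z.2 - z.1 • u z‖ ^ 2 := by positivity
        linarith
      calc T ^ (2 - k) / (γ - 1) * (pressure A γ (ρ z) * bump T z.1)
          = T ^ (2 - k) * (pressure A γ (ρ z) / (γ - 1) * bump T z.1) := by ring
        _ ≤ z.1 ^ 2 * z.1 ^ (-k) * (pressure A γ (ρ z) / (γ - 1) * bump T z.1) := by gcongr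
        _ = z.1 ^ 2 * (pressure A γ (ρ z) / (γ - 1)) * (z.1 ^ (-k) * bump T z.1) := by ring
        _ ≤ _ := by gcongr
    · simp [bump_eq_zero hzT]
  rw [integral_const_mul] at hle
  have h3 := hle.trans h
  rw [Real.rpow_neg hT0.le, ← div_eq_mul_inv, le_div_iff₀ (Real.rpow_pos_of_pos hT0 _)]
  calc _ = (γ - 1) * (T ^ (2 - k) / (γ - 1) *
        ∫ z in openHalf d, pressure A γ (ρ z) * bump T z.1) := by
        field_simp
    _ ≤ _ := mul_le_mul_of_nonneg_left h3 hγ1.le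

theorem measurableSet_domain (hF : IsRegularFlow A γ Ω N ρ u) : MeasurableSet Ω := by
  obtain ⟨U, hU, rfl⟩ := hF.dom.rel_open
  exact hU.measurableSet.inter isClosed_closedHalf.measurableSet

/-- By Fubini; the time interval has length one, so the bound on the slices is already the bound on
the slab. -/
theorem volume_slab_le (hF : IsRegularFlow A γ Ω N ρ u) (hT : 0 ≤ T) {M : ℝ}
    (hM : ∀ t ∈ Icc T (T + 1), volume.real (slice Ω t) ≤ M) :
    volume (Ω ∩ Prod.fst ⁻¹' Icc T (T + 1)) ≤ ENNReal.ofReal M := by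
  rw [Measure.volume_eq_prod, Measure.prod_apply
    (hF.measurableSet_domain.inter (measurable_fst measurableSet_Icc))]
  calc ∫⁻ t, volume (Prod.mk t ⁻¹' (Ω ∩ Prod.fst ⁻¹' Icc T (T + 1)))
      ≤ ∫⁻ t, (Icc T (T + 1)).indicator (fun _ => ENNReal.ofReal M) t := by
        refine lintegral_mono fun t => ?_
        by_cases ht : t ∈ Icc T (T + 1)
        · rw [indicator_of_mem ht]
          refine (measure_mono (show _ ⊆ slice Ω t from fun x hx => hx.1)).trans ?_
          rw [← ENNReal.ofReal_toReal
            (hF.dom.bounded t (hT.trans ht.1)).measure_lt_top.ne]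
          exact ENNReal.ofReal_le_ofReal (hM t ht)
        · rw [indicator_of_notMem ht]
          have : Prod.mk t ⁻¹' (Ω ∩ Prod.fst ⁻¹' Icc T (T + 1)) = ∅ :=
            eq_empty_of_forall_notMem fun x hx => ht hx.2
          rw [this, measure_empty]
    _ = ENNReal.ofReal M := by
        rw [lintegral_indicator measurableSet_Icc, setLIntegral_const, Real.volume_Icc]
        simp

/-- A splitting at the level `l` that replaces Hölder's inequality: above `l`, write `r = r ^ (1 -
γ) * r ^ γ` with a negative first exponent. -/
theorem le_add_rpow (hγ : 1 < γ) {r l : ℝ} (hr : 0 ≤ r) (hl : 0 < l) :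
    r ≤ l + l ^ (1 - γ) * r ^ γ := by
  rcases le_or_gt r l with h | h
  · have : 0 ≤ l ^ (1 - γ) * r ^ γ := by positivity
    linarith
  · have hr0 : 0 < r := hl.trans h
    have h1 : r ^ (1 - γ) ≤ l ^ (1 - γ) :=
      Real.rpow_le_rpow_of_nonpos hl h.le (by linarith)
    calc r = r ^ (1 - γ) * r ^ γ := by
          rw [← Real.rpow_add hr0, sub_add_cancel, Real.rpow_one]
      _ ≤ l ^ (1 - γ) * r ^ γ := by gcongr
      _ ≤ _ := by linarith

/-- Interpolation between the volume of the domain and the internal energy. -/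
theorem mass_le (hF : IsRegularFlow A γ Ω N ρ u) (hT : 0 < T) {M B l : ℝ} (hl : 0 < l)
    (hB0 : 0 ≤ B) (hB : ∀ t, bump T t ≤ B) (hM0 : 0 ≤ M)
    (hM : ∀ t ∈ Icc T (T + 1), volume.real (slice Ω t) ≤ M) :
    ∫ z in openHalf d, ρ z * bump T z.1 ≤ l * B * M
      + l ^ (1 - γ) * A⁻¹ * ∫ z in openHalf d, pressure A γ (ρ z) * bump T z.1 := by
  set S : Set (SpaceTime d) := Ω ∩ Prod.fst ⁻¹' Icc T (T + 1) with hS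
  have hSm : MeasurableSet S := hF.measurableSet_domain.inter (measurable_fst measurableSet_Icc)
  have hSv := hF.volume_slab_le hT.le hM
  have hSfin : volume S < ⊤ := hSv.trans_lt ENNReal.ofReal_lt_top
  have hSo : S ∩ openHalf d = S := inter_eq_left.2 fun z hz => lt_of_lt_of_le hT hz.2.1
  have i1 : IntegrableOn (S.indicator fun _ => l * B) (openHalf d) :=
    ((integrable_indicator_iff hSm).2 (integrableOn_const hSfin.ne)).integrableOn
  have e1 : ∫ z in openHalf d, S.indicator (fun _ => l * B) z ≤ l * B * M := by
    rw [integral_indicator hSm, Measure.restrict_restrict hSm, hSo, setIntegral_const,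
      smul_eq_mul, mul_comm]
    gcongr
    exact ENNReal.toReal_le_of_le_ofReal hM0 hSv
  have i2 := (hF.integrableOn_pressure_bump hT).const_mul (l ^ (1 - γ) * A⁻¹)
  rw [← integral_const_mul]
  refine (integral_mono_ae (hF.integrableOn_density_bump hT) (i1.add i2) ?_).trans ?_
  · filter_upwards [hF.ae_vacuum, ae_restrict_mem isOpen_openHalf.measurableSet] with z hz hzo
    have hρ := hF.sol.density_nonneg z (openHalf_subset_closedHalf hzo)
    have hb := bump_nonneg T z.1
    have hp : l ^ (1 - γ) * A⁻¹ * (pressure A γ (ρ z) * bump T z.1)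
        = l ^ (1 - γ) * ρ z ^ γ * bump T z.1 := by
      have := hF.hA.ne'
      rw [pressure]
      field_simp
    simp only [Pi.add_apply, hp]
    by_cases hzT : z.1 ∈ Icc T (T + 1)
    · rcases hz with hz | hz
      · rw [indicator_of_mem (show z ∈ S from ⟨hz, hzT⟩)]
        calc ρ z * bump T z.1 ≤ (l + l ^ (1 - γ) * ρ z ^ γ) * bump T z.1 := by
              gcongr
              exact le_add_rpow hF.hγ hρ hl
          _ = l * bump T z.1 + l ^ (1 - γ) * ρ z ^ γ * bump T z.1 := by ring
          _ ≤ _ := by gcongr; exact hB _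
      · rw [hz, zero_mul]
        have : 0 ≤ S.indicator (fun _ => l * B) z := indicator_nonneg (fun _ _ => by positivity) z
        positivity
    · rw [bump_eq_zero hzT, indicator_of_notMem fun h => hzT h.2]
      simp
  · have h2 := integral_add i1 i2
    refine h2.le.trans ?_
    gcongr

/-- The volume of a dispersing gas cannot grow slower than `t ^ d`. -/
theorem leadingCoeff_pos (hF : IsRegularFlow A γ Ω N ρ u) (hd : 1 ≤ d)
    (hγd : 1 < d → γ ≤ 1 + 1 / ((d : ℝ) - 1)) {a : ℕ → ℝ}
    (ha : ∀ t, 0 ≤ t → volume.real (slice Ω t) = ∑ j ∈ Finset.range (d + 1), a j * t ^ j) :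
    0 < a d := by
  by_contra! had
  set q : ℝ := ((d - 1 : ℕ) : ℝ) with hq
  have hq0 : 0 ≤ q := Nat.cast_nonneg _
  have hqd : (d : ℝ) = q + 1 := by rw [hq, Nat.cast_sub hd]; simp
  have hγ1 : 0 < γ - 1 := by linarith [hF.hγ]
  have hqγ : q * (γ - 1) ≤ 1 := by
    rcases hd.eq_or_lt with h1 | h1
    · have : q = 0 := by rw [hq, ← h1]; simp
      rw [this]; simp
    · have h2 := hγd h1
      have hqpos : 0 < q := by rw [hq]; exact_mod_cast Nat.sub_pos_of_lt h1
      rw [hqd, add_sub_cancel_right] at h2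
      calc q * (γ - 1) ≤ q * (1 / q) := by gcongr; linarith
        _ = 1 := by field_simp
  -- The smallest weight allowed by the dispersion inequality; it gives the decay exponent `2 - k =
  -- min 2 (d (γ - 1))`. This exceeds `(d - 1) (γ - 1)`, which is at most `1` by the upper bound on
  -- `γ`.
  set k : ℝ := max 0 (2 - d * (γ - 1)) with hk
  have hk2 : q * (γ - 1) < 2 - k := by
    have : k < 2 - q * (γ - 1) := by
      rw [hk, max_lt_iff]
      refine ⟨by linarith, ?_⟩
      rw [hqd]; nlinarith
    linarith
  have hqγ0 : 0 ≤ q * (γ - 1) := by positivity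
  obtain ⟨C, hC⟩ := hF.exists_pressure_decay (le_max_left _ _ : 0 ≤ k) (le_max_right _ _)
    (by linarith)
  obtain ⟨B, hB0, hB⟩ := exists_bump_le
  set c := ∑ j ∈ Finset.range d, |a j| with hc
  have hc0 : 0 ≤ c := Finset.sum_nonneg fun _ _ => abs_nonneg _
  set c₁ := c * 2 ^ (d - 1) with hc₁
  have hvol : ∀ T, 1 ≤ T → ∀ t ∈ Icc T (T + 1), volume.real (slice Ω t) ≤ c₁ * T ^ q := by
    intro T hT t ht
    have ht1 : 1 ≤ t := hT.trans ht.1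
    rw [ha t (by linarith), Finset.sum_range_succ]
    have h1 : ∑ j ∈ Finset.range d, a j * t ^ j ≤ c * t ^ (d - 1) := by
      rw [hc, Finset.sum_mul]
      refine Finset.sum_le_sum fun j hj => ?_
      have hj' : j ≤ d - 1 := Nat.le_sub_one_of_lt (Finset.mem_range.1 hj)
      exact mul_le_mul (le_abs_self _) (pow_le_pow_right₀ ht1 hj') (by positivity) (abs_nonneg _)
    have h2 : a d * t ^ d ≤ 0 := mul_nonpos_of_nonpos_of_nonneg had (by positivity)
    -- On the slab `t ≤ T + 1 ≤ 2 T`, which is the origin of the factor `2 ^ (d - 1)` in `c₁`.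
    have h3 : t ^ (d - 1) ≤ 2 ^ (d - 1) * T ^ (d - 1) := by
      rw [← mul_pow]
      exact pow_le_pow_left₀ (by linarith) (by linarith [ht.2]) _
    rw [hq, Real.rpow_natCast, hc₁, mul_assoc]
    have h4 := mul_le_mul_of_nonneg_left h3 hc0
    linarith
  set m := ∫ z in openHalf d, ρ z * bump 1 z.1 with hm
  have hm0 : 0 < m := hF.mass_pos hd
  have hc₁0 : 0 ≤ c₁ := by positivity
  -- Chosen so that the volume term `ε B c₁` stays below `m / 2`; the `+ 1` avoids a zero
  -- denominator.
  set ε := m / (2 * (B * c₁ + 1)) with hε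
  have hε0 : 0 < ε := by positivity
  have hAi : 0 < A⁻¹ := inv_pos.2 hF.hA
  have hbound : ∀ T, 1 ≤ T →
      m ≤ ε * (B * c₁) + ε ^ (1 - γ) * A⁻¹ * C * T ^ (-(2 - k - q * (γ - 1))) := by
    intro T hT
    have hT0 : 0 < T := by linarith
    -- The level `l = ε T ^ (-q)` exactly compensates the volume growth `T ^ q`. It costs a factor
    -- `T ^ (q (γ - 1))` on the pressure term, which the decay `T ^ (-(2 - k))` outweighs.
    have h1 := hF.mass_le hT0 (l := ε * T ^ (-q)) (by positivity) hB0 (hB T)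
      (M := c₁ * T ^ q) (by positivity) (hvol T hT)
    rw [hF.mass_eq hT] at h1
    have h2 : (ε * T ^ (-q)) ^ (1 - γ) * A⁻¹ *
        ∫ z in openHalf d, pressure A γ (ρ z) * bump T z.1
        ≤ (ε * T ^ (-q)) ^ (1 - γ) * A⁻¹ * (C * T ^ (-(2 - k))) := by
      gcongr
      exact hC T hT
    have e1 : ε * T ^ (-q) * B * (c₁ * T ^ q) = ε * (B * c₁) := by
      have : T ^ (-q) * T ^ q = 1 := by rw [← Real.rpow_add hT0, neg_add_cancel, Real.rpow_zero]
      linear_combination ε * B * c₁ * this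
    have e2 : (ε * T ^ (-q)) ^ (1 - γ) * A⁻¹ * (C * T ^ (-(2 - k)))
        = ε ^ (1 - γ) * A⁻¹ * C * T ^ (-(2 - k - q * (γ - 1))) := by
      rw [Real.mul_rpow hε0.le (by positivity), ← Real.rpow_mul hT0.le]
      have : T ^ (-q * (1 - γ)) * T ^ (-(2 - k)) = T ^ (-(2 - k - q * (γ - 1))) := by
        rw [← Real.rpow_add hT0]
        congr 1
        ring
      rw [← this]
      ring
    linarith
  have hlim : Filter.Tendsto (fun T : ℝ => ε * (B * c₁)
      + ε ^ (1 - γ) * A⁻¹ * C * T ^ (-(2 - k - q * (γ - 1)))) Filter.atTop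
      (𝓝 (ε * (B * c₁) + ε ^ (1 - γ) * A⁻¹ * C * 0)) :=
    ((tendsto_rpow_neg_atTop (by linarith)).const_mul _).const_add _
  have hle := ge_of_tendsto hlim ((Filter.eventually_ge_atTop 1).mono hbound)
  have hlt : ε * (B * c₁) < m := by
    have hBc : 0 ≤ B * c₁ := by positivity
    have : ε * (2 * (B * c₁ + 1)) = m := by rw [hε]; field_simp
    nlinarith
  linarith

end IsRegularFlow

end

end EulerVacuum

theorem mainTheorem4 (d : ℕ) (hd : 1 ≤ d) (A γ : ℝ) (hA : 0 < A) (hγ : 1 < γ)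
    (hγd : 1 < d → γ ≤ 1 + 1 / ((d : ℝ) - 1))
    (Ω : Set (EulerVacuum.SpaceTime d))
    (ρ : EulerVacuum.SpaceTime d → ℝ)
    (u : EulerVacuum.SpaceTime d → EulerVacuum.Space d)
    (hsol : EulerVacuum.IsAdmissibleSolution A γ ρ u)
    (hΩ : EulerVacuum.IsMovingDomain Ω)
    (hgas : EulerVacuum.IsGasRegion Ω ρ)
    (hC1 : EulerVacuum.IsC1NearFront A γ Ω ρ u) :
    (∃ v : EulerVacuum.Space d → EulerVacuum.Space d,
      EulerVacuum.IsC1Extension (EulerVacuum.slice Ω 0) (fun x => u (0, x)) v) ∧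
    ∀ v : EulerVacuum.Space d → EulerVacuum.Space d,
      EulerVacuum.IsC1Extension (EulerVacuum.slice Ω 0) (fun x => u (0, x)) v →
        0 < ∫ x in EulerVacuum.slice Ω 0, (fderiv ℝ v x).det := by
  obtain ⟨N, hN, hFN, hc, hu⟩ := hC1
  have hF : EulerVacuum.IsRegularFlow A γ Ω N ρ u :=
    ⟨hA, hγ, hsol, hΩ, hgas, hN, hFN, hc, hu⟩
  refine ⟨?_, fun v hv => ?_⟩
  · obtain ⟨w, hw, -, hwu⟩ := hF.exists_extension (t := 0) le_rfl
    exact ⟨w, ⟨univ, isOpen_univ, subset_univ _, hw.contDiffOn⟩, hwu⟩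
  · obtain ⟨a, had, ha⟩ := hF.exists_volume_slice_eq hv
    rw [← had]
    exact hF.leadingCoeff_pos hd hγd ha
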